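/- Let $d\ge 1$ and let $\mathcal M^d$ be the space of probability measures on the nearest neighbours $\{\pm e_i\}_{i=1}^d$ of the origin in $\mathbb Z^d$. An environment is a point $\omega=(\omega(z,\cdot))_{z\in\mathbb Z^d}\in(\mathcal M^d)^{\mathbb Z^d}$. Let $\nu$ be a probability measure on $\mathcal M^d$ and let $P=\nu^{\mathbb Z^d}$ be the law of the corresponding i.i.d. environment. Assume that $P$-almost surely $\omega$ is balanced, i.e. $\omega(z,e)=\omega(z,-e)$ for every $z\in\mathbb Z^d$ and every neighbour $e$ of the origin, and genuinely $d$-dimensional, i.e. for every neighbour $e$ of the origin there is $z\in\mathbb Z^d$ with $\omega(z,e)>0$. For $u:\mathbb Z^d\to\mathbb R$ put $L_\omega u(z)=u(z)-\sum_{e}\omega(z,e)\,u(z+e)$, the sum running over the $2d$ neighbours $e$ of the origin. For $x\in\mathbb Z^d$ and $r\geq 0$ let $B_r(x)=\{y\in\mathbb Z^d:|x-y|\le r\}$, where $|\cdot|$ is the Euclidean norm. For a finite nonempty set $A\subset\mathbb Z^d$, $p>0$ and $f:\mathbb Z^d\to\mathbb R$ let $\|f\|_{A,p}=\bigl(\frac1{|A|}\sum_{z\in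 A}|f(z)|^p\bigr)^{1/p}$. Write $u^+=\max(u,0)$. **Theorem (mean value inequality).** For every $\sigma\in(0,1)$ and every real $p$ with $0<p\le d$ there is a constant $C\in(0,\infty)$, depending only on $\sigma$, $p$, $d$ and the law $\nu$, such that for every $x_0\in\mathbb Z^d$ the following holds for $P$-almost every $\omega$: there is $N_0\in\mathbb N$ (which may depend on $\omega$, $\sigma$, $p$, $d$, $\nu$, $x_0$) such that for every integer $N\ge N_0$ and every $u:\mathbb Z^d\to\mathbb R$ with $$L_\omega u(x)=0\qquad\text{for all }x\in B_N(x_0)$$ one has $$\max_{B_{\sigma N}(x_0)}u\;\le\; C\,\|u^+\|_{B_N(x_0),p}.$$ (Only the values of $u$ on $B_N(x_0)$ and on the lattice neighbours of its points enter, so $u$ may equally be given only there.) -/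

import Mathlib

open MeasureTheory

namespace BalancedRWRE

/-- Sites of the lattice `ℤ^d`. -/
abbrev Site (d : ℕ) : Type := Fin d → ℤ

/-- Labels of the `2 d` nearest neighbours of the origin: `(i, true)` stands for `e_i` and
`(i, false)` for `-e_i`. -/
abbrev Dir (d : ℕ) : Type := Fin d × Bool

/-- The neighbour of the origin with the given label. -/
def step {d : ℕ} (e : Dir d) : Site d := Pi.single e.1 (if e.2 then 1 else -1)

/-- The neighbour opposite to a given one. -/
def Dir.opp {d : ℕ} (e : Dir d) : Dir d := (e.1, !e.2)

theorem step_opp {d : ℕ} (e : Dir d) : step (Dir.opp e) = -step e := by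
  obtain ⟨i, b⟩ := e
  cases b <;> simp [step, Dir.opp, ← Pi.single_neg]

/-- The space of probability measures on the nearest neighbours of the origin (as probability
vectors), with its Borel sigma-algebra. -/
abbrev JumpLaw (d : ℕ) : Type := stdSimplex ℝ (Dir d)

/-- An environment attaches a jump law to every site. -/
abbrev Environment (d : ℕ) : Type := Site d → JumpLaw d

/-- `prob ω z e` is the probability `ω(z, e)` to jump from `z` to `z + e`. -/
def prob {d : ℕ} (ω : Environment d) (z : Site d) (e : Dir d) : ℝ := (ω z).1 e

/-- The law of the i.i.d. environment whose jump law at each site has distribution `ν`. -/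
noncomputable def iidLaw {d : ℕ} (ν : Measure (JumpLaw d)) : Measure (Environment d) :=
  Measure.infinitePi (fun _ : Site d => ν)

/-- `ω(z, e) = ω(z, -e)` for every site `z` and neighbour `e` of the origin. -/
def IsBalanced {d : ℕ} (ω : Environment d) : Prop :=
  ∀ (z : Site d) (e : Dir d), prob ω z e = prob ω z e.opp

/-- Every neighbour `e` of the origin has `ω(z, e) > 0` for some site `z`. -/
def IsGenuinelyDDim {d : ℕ} (ω : Environment d) : Prop :=
  ∀ e : Dir d, ∃ z : Site d, 0 < prob ω z e

/-- `L_ω u (z) = u(z) - E_ω^z[u(X_1)]`, where `X_1 = z + e` with probability `ω(z, e)`. -/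
noncomputable def gen {d : ℕ} (ω : Environment d) (u : Site d → ℝ) (z : Site d) : ℝ :=
  u z - ∑ e : Dir d, prob ω z e * u (z + step e)

/-- The Euclidean distance between two sites. -/
noncomputable def eDist {d : ℕ} (x y : Site d) : ℝ :=
  Real.sqrt (∑ i, ((x i : ℝ) - (y i : ℝ)) ^ 2)

theorem finite_setOf_eDist_le {d : ℕ} (x : Site d) (r : ℝ) :
    {y : Site d | eDist x y ≤ r}.Finite := by
  refine (Set.finite_Icc (fun i => x i - ⌈r⌉) (fun i => x i + ⌈r⌉)).subset ?_
  intro y hy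
  have key : ∀ i, |(x i : ℝ) - (y i : ℝ)| ≤ (⌈r⌉ : ℝ) := by
    intro i
    refine le_trans ?_ (le_trans hy (Int.le_ceil r))
    rw [← Real.sqrt_sq_eq_abs]
    exact Real.sqrt_le_sqrt (Finset.single_le_sum
      (f := fun i => ((x i : ℝ) - (y i : ℝ)) ^ 2) (fun j _ => sq_nonneg _) (Finset.mem_univ i))
  refine ⟨fun i => ?_, fun i => ?_⟩
  · have h := (abs_le.mp (key i)).2
    have h2 : x i - y i ≤ ⌈r⌉ := by exact_mod_cast h
    show x i - ⌈r⌉ ≤ y i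
    omega
  · have h := (abs_le.mp (key i)).1
    have h2 : -⌈r⌉ ≤ x i - y i := by exact_mod_cast h
    show y i ≤ x i + ⌈r⌉
    omega

/-- The lattice ball `B_r(x)`: all sites `y` with `|x - y| ≤ r` in the Euclidean norm. -/
noncomputable def ball {d : ℕ} (x : Site d) (r : ℝ) : Finset (Site d) :=
  (finite_setOf_eDist_le x r).toFinset

theorem mem_ball {d : ℕ} {x y : Site d} {r : ℝ} : y ∈ ball x r ↔ eDist x y ≤ r := by
  simp [ball]

/-- The `L^p` norm with respect to the uniform probability measure on the finite set `A`. -/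
noncomputable def avgNorm {d : ℕ} (A : Finset (Site d)) (p : ℝ) (f : Site d → ℝ) : ℝ :=
  ((1 / (A.card : ℝ)) * ∑ z ∈ A, |f z| ^ p) ^ (1 / p)

end BalancedRWRE

namespace BalancedRWRE

/-! The proof is an Alexandrov–Bakelman–Pucci (ABP) argument in which uniform ellipticity is
replaced by a random time scale `κ z`: a time by which, for each axis, the walk from `z` has jumped
along it with probability at least 1/2.

Deterministic half. The positive part `f = u⁺` is subharmonic on the ball. Write `f = s ^ m` and
localise by the cut-off `q = 1 - |y - x₀|² / N²`, setting `v = (q ^ (2d) s) ^ m` in the ball and 0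
outside. Let `μ` be the maximum of `q ^ (2d) s`. Every slope of size at most a constant times `μ ^ m
/ N` supports the graph of `v` from above at some `z` of the ball. For two slopes supporting at the
same `z`, the difference of the supporting functions is a martingale along the balanced walk. Its
mean absolute value at time `κ z` is at most twice the mean gap between `v` and one supporting
hyperplane (`abs_slope_sub_le`), and it controls each coordinate because that axis has probably been
used (`IsBalanced.le_evol_abs`). Subharmonicity bounds the mean gap by `C v κ² / (N² q²)`
(`exists_contact_bound`). Comparing volumes in slope space gives `μ ≤ C N^(-d) ∑ κ ^ (2d) s`
(`exists_abp_bound`): the power `2d` of the cut-off pays for the factor `q ^ (-2d)`, and the bound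
is linear in `s`. Cauchy–Schwarz and a choice of `m` with `2 / m ≤ p` then give every small
exponent, provided `∑ κ ^ (4d) ≤ C N ^ d` (`exists_mean_value_of_scale`).

Probabilistic half. A walk that avoids an axis for `k` steps either explores at least `r` sites,
each new one giving an independent chance to jump along the axis (`integral_mul_avoidMany_le`), or
stays confined to a small ball, which is unlikely since its squared distance has drift 1
(`IsBalanced.avoidFew_le`). Taking `r` of order `k ^ (1/4)`, the tail of `κ` decays faster than any
power. Truncated powers of `κ` have finite range of dependence, so Chebyshev's inequality and
Borel–Cantelli give the required moment bound on all large balls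
(`exists_escapeScale_moment_bound`). -/

theorem prob_nonneg {d : ℕ} (ω : Environment d) (z : Site d) (e : Dir d) : 0 ≤ prob ω z e :=
  (ω z).2.1 e

theorem sum_prob {d : ℕ} (ω : Environment d) (z : Site d) : ∑ e, prob ω z e = 1 :=
  (ω z).2.2

theorem prob_le_one {d : ℕ} (ω : Environment d) (z : Site d) (e : Dir d) : prob ω z e ≤ 1 := by
  rw [← sum_prob ω z]
  exact Finset.single_le_sum (fun e _ => prob_nonneg ω z e) (Finset.mem_univ e)

/-! ### Expectations along the walk, martingales, and avoidance of an axis -/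

/-- The `ℓ¹` distance between two sites. -/
def l1 {d : ℕ} (y z : Site d) : ℕ := ∑ i, (y i - z i).natAbs

theorem l1_self {d : ℕ} (z : Site d) : l1 z z = 0 := by simp [l1]

theorem l1_triangle {d : ℕ} (x y z : Site d) : l1 x z ≤ l1 x y + l1 y z := by
  unfold l1
  rw [← Finset.sum_add_distrib]
  exact Finset.sum_le_sum fun i _ => by omega

theorem l1_add_step {d : ℕ} (z : Site d) (e : Dir d) : l1 (z + step e) z = 1 := by
  unfold l1
  rw [Finset.sum_eq_single e.1]
  · obtain ⟨i, b⟩ := e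
    cases b <;> simp [step]
  · intro j _ hj
    simp [step, Pi.single_eq_of_ne hj]
  · simp

theorem natAbs_le_l1 {d : ℕ} (y z : Site d) (i : Fin d) : (y i - z i).natAbs ≤ l1 y z :=
  Finset.single_le_sum (f := fun i => (y i - z i).natAbs) (fun _ _ => Nat.zero_le _)
    (Finset.mem_univ i)

theorem abs_sub_le_l1 {d : ℕ} (y z : Site d) (i : Fin d) :
    |(y i : ℝ) - z i| ≤ (l1 y z : ℝ) := by
  have h := natAbs_le_l1 y z i
  have h2 : |y i - z i| ≤ (l1 y z : ℤ) := by rw [Int.abs_eq_natAbs]; exact_mod_cast h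
  exact_mod_cast h2

theorem cast_l1 {d : ℕ} (y z : Site d) : (l1 y z : ℝ) = ∑ i, |(y i : ℝ) - z i| := by
  unfold l1
  push_cast
  refine Finset.sum_congr rfl fun i _ => ?_
  rw [Nat.cast_natAbs]
  push_cast
  rfl

/-- `evol ω k F z` is the expectation of `F (X_k)` for the walk in `ω` started at `z`. -/
noncomputable def evol {d : ℕ} (ω : Environment d) : ℕ → (Site d → ℝ) → Site d → ℝ
  | 0, F, z => F z
  | k + 1, F, z => ∑ e, prob ω z e * evol ω k F (z + step e)

/-- The probability that the walk started at `z` makes no jump along the axis `i` in its first `k`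
steps. -/
noncomputable def avoid {d : ℕ} (ω : Environment d) (i : Fin d) : ℕ → Site d → ℝ
  | 0, _ => 1
  | k + 1, z => ∑ e, if e.1 = i then 0 else prob ω z e * avoid ω i k (z + step e)

section evol

variable {d : ℕ} {ω : Environment d}

theorem evol_mono {F G : Site d → ℝ} (k : ℕ) (z : Site d)
    (h : ∀ y, l1 y z ≤ k → F y ≤ G y) : evol ω k F z ≤ evol ω k G z := by
  induction k generalizing z with
  | zero => exact h z (by simp [l1_self])
  | succ k ih =>
    refine Finset.sum_le_sum fun e _ => mul_le_mul_of_nonneg_left (ih _ fun y hy => h y ?_)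
      (prob_nonneg _ _ _)
    have := l1_triangle y (z + step e) z
    rw [l1_add_step] at this
    omega

theorem evol_add (F G : Site d → ℝ) (k : ℕ) (z : Site d) :
    evol ω k (fun y => F y + G y) z = evol ω k F z + evol ω k G z := by
  induction k generalizing z with
  | zero => rfl
  | succ k ih => simp only [evol, ih, mul_add, Finset.sum_add_distrib]

theorem evol_mul_left (c : ℝ) (F : Site d → ℝ) (k : ℕ) (z : Site d) :
    evol ω k (fun y => c * F y) z = c * evol ω k F z := by
  induction k generalizing z with
  | zero => rfl
  | succ k ih =>
    simp only [evol, ih, Finset.mul_sum]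
    exact Finset.sum_congr rfl fun e _ => by ring

theorem evol_of_step {F : Site d → ℝ} {c : ℝ}
    (h : ∀ z, ∑ e, prob ω z e * F (z + step e) = F z + c) (k : ℕ) (z : Site d) :
    evol ω k F z = F z + k * c := by
  induction k generalizing z with
  | zero => simp [evol]
  | succ k ih =>
    simp only [evol, ih, mul_add, Finset.sum_add_distrib, ← Finset.sum_mul, sum_prob, h]
    push_cast
    ring

theorem evol_const (c : ℝ) (k : ℕ) (z : Site d) : evol ω k (fun _ => c) z = c := by
  have := evol_of_step (ω := ω) (F := fun _ => c) (c := 0)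
    (fun z => by rw [← Finset.sum_mul, sum_prob]; ring) k z
  simpa using this

/-- The submartingale inequality, with subharmonicity asked only where the walk can be within `k`
steps: the functions in question are subharmonic only on a ball. -/
theorem le_evol {F : Site d → ℝ} (k : ℕ) (z : Site d)
    (h : ∀ y, l1 y z ≤ k → F y ≤ ∑ e, prob ω y e * F (y + step e)) : F z ≤ evol ω k F z := by
  induction k generalizing z with
  | zero => rfl
  | succ k ih =>
    refine (h z (by simp [l1_self])).trans ?_
    refine Finset.sum_le_sum fun e _ => mul_le_mul_of_nonneg_left (ih _ fun y hy => h y ?_)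
      (prob_nonneg _ _ _)
    have := l1_triangle y (z + step e) z
    rw [l1_add_step] at this
    omega

theorem sum_dir (f : Dir d → ℝ) : ∑ e, f e = ∑ i, (f (i, true) + f (i, false)) := by
  rw [Fintype.sum_prod_type]
  simp

theorem IsBalanced.prob_false (hω : IsBalanced ω) (z : Site d) (i : Fin d) :
    prob ω z (i, false) = prob ω z (i, true) := hω z (i, false)

theorem IsBalanced.two_mul_sum (hω : IsBalanced ω) (z : Site d) :
    ∑ i, 2 * prob ω z (i, true) = 1 := by
  rw [← sum_prob ω z, sum_dir]
  exact Finset.sum_congr rfl fun i _ => by rw [hω.prob_false]; ring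

theorem step_apply (i j : Fin d) (b : Bool) :
    ((step (i, b) : Site d) j : ℝ) = if j = i then (if b then 1 else -1) else 0 := by
  cases b <;> by_cases h : j = i <;> simp [step, h]

theorem sum_mul_step (θ : Fin d → ℝ) (i : Fin d) (b : Bool) :
    ∑ j, θ j * ((step (i, b) : Site d) j : ℝ) = if b then θ i else -θ i := by
  rw [Finset.sum_eq_single i]
  · rw [step_apply]; cases b <;> simp
  · intro j _ hj
    rw [step_apply]; simp [hj]
  · simp

theorem IsBalanced.sum_affine (hω : IsBalanced ω) (c : ℝ) (θ : Fin d → ℝ) (z : Site d) :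
    ∑ e, prob ω z e * (c + ∑ j, θ j * ((z + step e) j : ℝ)) = c + ∑ j, θ j * (z j : ℝ) := by
  have h : ∀ e : Dir d, c + ∑ j, θ j * ((z + step e) j : ℝ) =
      (c + ∑ j, θ j * (z j : ℝ)) + ∑ j, θ j * (step e j : ℝ) := by
    intro e
    rw [add_assoc, ← Finset.sum_add_distrib]
    congr 1
    refine Finset.sum_congr rfl fun j _ => ?_
    rw [Pi.add_apply]; push_cast; ring
  simp only [h, mul_add, Finset.sum_add_distrib, ← Finset.sum_mul, sum_prob, one_mul]
  rw [add_eq_left, sum_dir]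
  refine Finset.sum_eq_zero fun i _ => ?_
  rw [sum_mul_step, sum_mul_step, hω.prob_false]
  simp

theorem IsBalanced.evol_affine (hω : IsBalanced ω) (c : ℝ) (θ : Fin d → ℝ) (k : ℕ) (z : Site d) :
    evol ω k (fun y => c + ∑ j, θ j * (y j : ℝ)) z = c + ∑ j, θ j * (z j : ℝ) := by
  have := evol_of_step (ω := ω) (F := fun y => c + ∑ j, θ j * (y j : ℝ)) (c := 0)
    (fun z => by rw [hω.sum_affine, add_zero]) k z
  simpa using this

/-- The squared Euclidean distance. -/
noncomputable def distSq (y x₀ : Site d) : ℝ := ∑ i, ((y i : ℝ) - x₀ i) ^ 2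

theorem distSq_nonneg (y x₀ : Site d) : 0 ≤ distSq y x₀ :=
  Finset.sum_nonneg fun _ _ => sq_nonneg _

theorem distSq_add_step (y x₀ : Site d) (i : Fin d) (b : Bool) :
    distSq (y + step (i, b)) x₀ =
      distSq y x₀ + 1 + (if b then 2 * ((y i : ℝ) - x₀ i) else -(2 * ((y i : ℝ) - x₀ i))) := by
  have h : ∀ j, (((y + step (i, b)) j : ℤ) : ℝ) - x₀ j = ((y j : ℝ) - x₀ j) +
      ((step (i, b) : Site d) j : ℝ) := by
    intro j; rw [Pi.add_apply]; push_cast; ring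
  have h2 : ∑ j, (((step (i, b) : Site d) j : ℝ)) ^ 2 = 1 := by
    rw [Finset.sum_eq_single i]
    · rw [step_apply]; cases b <;> simp
    · intro j _ hj
      rw [step_apply]; simp [hj]
    · simp
  unfold distSq
  simp only [h, add_sq, Finset.sum_add_distrib, h2]
  rw [sum_mul_step (fun j => 2 * ((y j : ℝ) - x₀ j)) i b]
  ring

/-- A jump `±e_i` changes the squared distance by 1 plus or minus a linear term, and balance cancels
the linear terms. The drift is therefore 1 whatever the jump law, with no ellipticity. -/
theorem IsBalanced.sum_distSq (hω : IsBalanced ω) (x₀ z : Site d) :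
    ∑ e, prob ω z e * distSq (z + step e) x₀ = distSq z x₀ + 1 := by
  have h : ∀ i, prob ω z (i, true) * distSq (z + step (i, true)) x₀ +
      prob ω z (i, false) * distSq (z + step (i, false)) x₀ =
      (2 * prob ω z (i, true)) * (distSq z x₀ + 1) := by
    intro i
    rw [distSq_add_step, distSq_add_step, hω.prob_false]
    simp only [if_true, Bool.false_eq_true, if_false]
    ring
  rw [sum_dir]
  simp only [h]
  rw [← Finset.sum_mul, hω.two_mul_sum, one_mul]

theorem IsBalanced.evol_distSq (hω : IsBalanced ω) (x₀ : Site d) (k : ℕ) (z : Site d) :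
    evol ω k (fun y => distSq y x₀) z = distSq z x₀ + k := by
  have := evol_of_step (ω := ω) (F := fun y => distSq y x₀) (fun z => hω.sum_distSq x₀ z) k z
  simpa using this

theorem avoid_nonneg (i : Fin d) (k : ℕ) (z : Site d) : 0 ≤ avoid ω i k z := by
  induction k generalizing z with
  | zero => simp [avoid]
  | succ k ih =>
    refine Finset.sum_nonneg fun e _ => ?_
    split_ifs
    · rfl
    · exact mul_nonneg (prob_nonneg _ _ _) (ih _)

theorem avoid_le_one (i : Fin d) (k : ℕ) (z : Site d) : avoid ω i k z ≤ 1 := by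
  induction k generalizing z with
  | zero => simp [avoid]
  | succ k ih =>
    rw [← sum_prob ω z]
    refine Finset.sum_le_sum fun e _ => ?_
    split_ifs
    · exact prob_nonneg _ _ _
    · exact mul_le_of_le_one_right (prob_nonneg _ _ _) (ih _)

/-- A jump along the axis `i` makes the value of a linear functional spread by its `i`-th
coefficient. -/
theorem IsBalanced.le_evol_abs (hω : IsBalanced ω) (θ : Fin d → ℝ) (c : ℝ) (i : Fin d) (k : ℕ)
    (z : Site d) :
    |θ i| * (1 - avoid ω i k z) ≤ evol ω k (fun y => |c + ∑ j, θ j * (y j : ℝ)|) z := by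
  have hsub : ∀ y, |c + ∑ j, θ j * (y j : ℝ)| ≤
      ∑ e, prob ω y e * |c + ∑ j, θ j * ((y + step e) j : ℝ)| := by
    intro y
    rw [← hω.sum_affine c θ y]
    refine (Finset.abs_sum_le_sum_abs _ _).trans (Finset.sum_le_sum fun e _ => ?_)
    rw [abs_mul, abs_of_nonneg (prob_nonneg _ _ _)]
  induction k generalizing z with
  | zero => simp [avoid, evol]
  | succ k ih =>
    have key : |θ i| * (1 - avoid ω i (k + 1) z) =
        ∑ e : Dir d, prob ω z e *
          (if e.1 = i then |θ i| else |θ i| * (1 - avoid ω i k (z + step e))) := by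
      rw [avoid]
      conv_lhs => rw [← sum_prob ω z, ← Finset.sum_sub_distrib, Finset.mul_sum]
      refine Finset.sum_congr rfl fun e _ => ?_
      split_ifs <;> ring
    rw [key, evol, sum_dir, sum_dir]
    refine Finset.sum_le_sum fun j _ => ?_
    by_cases hj : j = i
    -- The jumps `±e_i` are equally likely and `|a + θ_i| + |a - θ_i| ≥ 2 |θ_i|`. Later steps cannot
    -- lower the mean, since the absolute value of an affine function is subharmonic.
    · subst hj
      simp only [if_true]
      rw [hω.prob_false, ← mul_add, ← mul_add]
      refine mul_le_mul_of_nonneg_left ?_ (prob_nonneg _ _ _)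
      have h1 := le_evol (ω := ω) k (z + step (j, true)) (fun y _ => hsub y)
      have h2 := le_evol (ω := ω) k (z + step (j, false)) (fun y _ => hsub y)
      refine le_trans ?_ (add_le_add h1 h2)
      have h : ∀ b, c + ∑ l, θ l * (((z + step (j, b)) l : ℤ) : ℝ) =
          (c + ∑ l, θ l * (z l : ℝ)) + (if b then θ j else -θ j) := by
        intro b
        rw [← sum_mul_step, add_assoc, ← Finset.sum_add_distrib]
        congr 1
        refine Finset.sum_congr rfl fun j _ => ?_
        rw [Pi.add_apply]; push_cast; ring
      rw [h, h]
      simp only [if_true, Bool.false_eq_true, if_false]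
      generalize c + ∑ l, θ l * (z l : ℝ) = a
      have := abs_sub (a + θ j) (a + -θ j)
      have h3 : a + θ j - (a + -θ j) = 2 * θ j := by ring
      rw [h3, abs_mul, abs_two] at this
      linarith
    · simp only [hj, if_false]
      exact add_le_add (mul_le_mul_of_nonneg_left (ih _) (prob_nonneg _ _ _))
        (mul_le_mul_of_nonneg_left (ih _) (prob_nonneg _ _ _))

end evol

/-! ### Contact points of a localised subharmonic function -/

/-- Expands the ratio of the cut-off powers at a contact point and at a nearby site. The linear term
is averaged exactly along the walk; the quadratic one is an error. -/
theorem exists_inv_one_sub_pow_bound (n : ℕ) : ∃ C : ℝ, 0 ≤ C ∧ ∀ δ : ℝ, |δ| ≤ 1 / 2 →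
    |((1 - δ) ^ n)⁻¹ - 1 - n * δ| ≤ C * δ ^ 2 := by
  induction n with
  | zero => exact ⟨0, le_rfl, fun δ _ => by simp⟩
  | succ n ih =>
    obtain ⟨C, hC, h⟩ := ih
    refine ⟨2 * (C + n + 1), by positivity, fun δ hδ => ?_⟩
    have hpos : 1 / 2 ≤ 1 - δ := by linarith [(abs_le.mp hδ).2]
    have hne : 1 - δ ≠ 0 := by linarith
    have e : ((1 - δ) ^ (n + 1))⁻¹ - 1 - ((n + 1 : ℕ) : ℝ) * δ =
        ((((1 - δ) ^ n)⁻¹ - 1 - n * δ) + (n + 1) * δ ^ 2) * (1 - δ)⁻¹ := by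
      rw [pow_succ, mul_inv]
      field_simp
      push_cast
      ring
    have h2 : (1 - δ)⁻¹ ≤ 2 := by
      rw [inv_le_comm₀ (by linarith) two_pos]; linarith
    have h3 : |(((1 - δ) ^ n)⁻¹ - 1 - n * δ) + (n + 1) * δ ^ 2| ≤ (C + n + 1) * δ ^ 2 := by
      refine (abs_add_le _ _).trans ?_
      rw [abs_of_nonneg (by positivity : 0 ≤ ((n : ℝ) + 1) * δ ^ 2)]
      linarith [h δ hδ]
    rw [e, abs_mul, abs_of_nonneg (inv_nonneg.mpr (by linarith : 0 ≤ 1 - δ))]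
    calc _ ≤ ((C + n + 1) * δ ^ 2) * 2 :=
          mul_le_mul h3 h2 (inv_nonneg.mpr (by linarith)) (by positivity)
      _ = _ := by ring

section contact

variable {d : ℕ} {ω : Environment d}

theorem abs_sub_le_of_distSq_le {x₀ y : Site d} {N : ℝ} (hN : 0 ≤ N) (h : distSq y x₀ ≤ N ^ 2)
    (i : Fin d) : |(y i : ℝ) - x₀ i| ≤ N := by
  refine abs_le_of_sq_le_sq ?_ hN
  exact (Finset.single_le_sum (f := fun i => ((y i : ℝ) - x₀ i) ^ 2) (fun _ _ => sq_nonneg _)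
    (Finset.mem_univ i)).trans h

theorem abs_distSq_sub_le {x₀ y z : Site d} {N k : ℝ} (hz : distSq z x₀ ≤ N ^ 2)
    (hy : (l1 y z : ℝ) ≤ k) (hkN : k ≤ N) : |distSq y x₀ - distSq z x₀| ≤ 3 * k * N := by
  have hN : 0 ≤ N := (Nat.cast_nonneg _).trans (hy.trans hkN)
  have h1 : |distSq y x₀ - distSq z x₀| ≤ ∑ i, |(y i : ℝ) - z i| * (3 * N) := by
    unfold distSq
    rw [← Finset.sum_sub_distrib]
    refine (Finset.abs_sum_le_sum_abs _ _).trans (Finset.sum_le_sum fun i _ => ?_)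
    have e : ((y i : ℝ) - x₀ i) ^ 2 - ((z i : ℝ) - x₀ i) ^ 2 =
        ((y i : ℝ) - z i) * (((y i : ℝ) - z i) + 2 * ((z i : ℝ) - x₀ i)) := by ring
    rw [e, abs_mul]
    refine mul_le_mul_of_nonneg_left ?_ (abs_nonneg _)
    refine (abs_add_le _ _).trans ?_
    rw [abs_mul, abs_two]
    have h2 := abs_sub_le_of_distSq_le hN hz i
    have h3 := (abs_sub_le_l1 y z i).trans (hy.trans hkN)
    linarith
  rw [← Finset.sum_mul, ← cast_l1] at h1
  nlinarith

/-- The quadratic cut-off attached to the ball of radius `N` around `x₀`. -/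
noncomputable def cutoff (x₀ : Site d) (N : ℝ) (y : Site d) : ℝ := 1 - distSq y x₀ / N ^ 2

theorem cutoff_le_one (x₀ : Site d) (N : ℝ) (y : Site d) : cutoff x₀ N y ≤ 1 := by
  have : 0 ≤ distSq y x₀ / N ^ 2 := div_nonneg (distSq_nonneg _ _) (sq_nonneg _)
  unfold cutoff
  linarith

theorem cutoff_nonneg_iff {x₀ : Site d} {N : ℝ} (hN : 0 < N) (y : Site d) :
    0 ≤ cutoff x₀ N y ↔ distSq y x₀ ≤ N ^ 2 := by
  rw [cutoff, sub_nonneg, div_le_one (by positivity)]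

/-- At a contact point, a localised subharmonic function is close to its supporting hyperplane on
average along the walk. -/
theorem exists_contact_bound (n : ℕ) : ∃ C : ℝ, 0 < C ∧
    ∀ {d : ℕ} {ω : Environment d}, IsBalanced ω → ∀ (x₀ z : Site d) (N k : ℕ), 1 ≤ k → k ≤ N →
    ∀ (U v : Site d → ℝ) (ℓ : Fin d → ℝ), (∀ y, 0 ≤ v y) →
    (∀ y, 0 ≤ cutoff x₀ N y → U y ≤ ∑ e, prob ω y e * U (y + step e)) →
    (∀ y, 0 ≤ cutoff x₀ N y → v y = cutoff x₀ N y ^ n * U y) →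
    0 < cutoff x₀ N z →
    (∀ y, l1 y z ≤ k → |∑ j, ℓ j * ((y j : ℝ) - z j)| ≤ v z * (k / N)) →
    (∀ y, l1 y z ≤ k → v y ≤ v z + ∑ j, ℓ j * ((y j : ℝ) - z j)) →
    evol ω k (fun y => v z + ∑ j, ℓ j * ((y j : ℝ) - z j) - v y) z ≤
      C * (v z * k ^ 2 / (N ^ 2 * cutoff x₀ N z ^ 2)) := by
  obtain ⟨C₁, hC₁, hexp⟩ := exists_inv_one_sub_pow_bound n
  set C₂ : ℝ := 9 * C₁ + 3 * (n + C₁) with hC₂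
  refine ⟨(3 / 2) ^ n * (n + C₂) + 72, by positivity, ?_⟩
  intro d ω hω x₀ z N k hk hkN U v ℓ hv0 hU hvU hq hℓ hcon
  have hk' : (1 : ℝ) ≤ k := by exact_mod_cast hk
  have hkN' : (k : ℝ) ≤ N := by exact_mod_cast hkN
  have hN : (0 : ℝ) < N := by linarith
  set q := cutoff x₀ N z with hqdef
  have hq1 : q ≤ 1 := cutoff_le_one _ _ _
  set B : ℝ := v z * k ^ 2 / (N ^ 2 * q ^ 2) with hB
  have hvz := hv0 z
  have hB0 : 0 ≤ B := by positivity
  by_cases hcase : 6 * (k : ℝ) ≤ N * q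
  · set b : ℝ := n * v z / (N ^ 2 * q) with hb
    have hzd : distSq z x₀ ≤ (N : ℝ) ^ 2 := (cutoff_nonneg_iff hN z).mp hq.le
    -- `F` dominates the gap times `(q / cutoff y) ^ n`. It is built from pieces whose means are
    -- under control: an affine function, the squared distance, and `-U`, with all expansion errors
    -- collected in `C₂ * B`.
    set F : Site d → ℝ := fun y => ((v z - ∑ j, ℓ j * (z j : ℝ) - b * distSq z x₀ + C₂ * B) +
      ∑ j, ℓ j * (y j : ℝ)) + (b * distSq y x₀ + (-(q ^ n)) * U y) with hF
    have hpt : ∀ y, l1 y z ≤ k →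
        0 ≤ cutoff x₀ N y ∧ v z + ∑ j, ℓ j * ((y j : ℝ) - z j) - v y ≤ (3 / 2) ^ n * F y := by
      intro y hy
      have hyk : (l1 y z : ℝ) ≤ k := by exact_mod_cast hy
      set δ : ℝ := (distSq y x₀ - distSq z x₀) / (N ^ 2 * q) with hδ
      have hδk : |δ| ≤ 3 * k / (N * q) := by
        rw [hδ, abs_div, abs_of_pos (by positivity : (0 : ℝ) < N ^ 2 * q)]
        rw [div_le_div_iff₀ (by positivity) (by positivity)]
        have := abs_distSq_sub_le hzd hyk hkN'
        calc |distSq y x₀ - distSq z x₀| * (N * q) ≤ (3 * k * N) * (N * q) :=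
              mul_le_mul_of_nonneg_right this (by positivity)
          _ = _ := by ring
      have hδ2 : |δ| ≤ 1 / 2 := by
        refine hδk.trans ?_
        rw [div_le_div_iff₀ (by positivity) two_pos]
        linarith
      have hqy : cutoff x₀ N y = q * (1 - δ) := by
        have hz : distSq z x₀ = N ^ 2 * (1 - q) := by
          rw [hqdef, cutoff]; field_simp; ring
        rw [hδ, cutoff, hz]
        field_simp
        ring
      obtain ⟨hδl, hδu⟩ := abs_le.mp hδ2
      have hcy : 0 ≤ cutoff x₀ N y := by rw [hqy]; exact mul_nonneg hq.le (by linarith)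
      refine ⟨hcy, ?_⟩
      set g : ℝ := ((1 - δ) ^ n)⁻¹ with hg
      have h1δ : 0 < 1 - δ := by linarith
      have hg0 : 0 < g := by positivity
      have hvg : v y * g = q ^ n * U y := by
        rw [hvU y hcy, hqy, mul_pow, hg]
        field_simp
      have hgl : 1 ≤ (3 / 2) ^ n * g := by
        rw [hg, ← div_eq_mul_inv, one_le_div (by positivity)]
        exact pow_le_pow_left₀ h1δ.le (by linarith) n
      set t : ℝ := ∑ j, ℓ j * ((y j : ℝ) - z j) with ht
      have hW : 0 ≤ v z + t - v y := by linarith [hcon y hy]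
      have hex := hexp δ hδ2
      rw [← hg] at hex
      have hsq : δ ^ 2 ≤ 9 * (k ^ 2 / (N ^ 2 * q ^ 2)) := by
        rw [← sq_abs]
        refine (pow_le_pow_left₀ (abs_nonneg _) hδk 2).trans (le_of_eq ?_)
        field_simp; norm_num
      have hg1 : |g - 1| ≤ (n + C₁) * (3 * k / (N * q)) := by
        have e : g - 1 = (g - 1 - n * δ) + n * δ := by ring
        rw [e]
        refine (abs_add_le _ _).trans ?_
        rw [abs_mul, Nat.abs_cast]
        have h4 : δ ^ 2 ≤ |δ| := by rw [← sq_abs]; nlinarith [abs_nonneg δ]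
        have h5 : C₁ * δ ^ 2 ≤ C₁ * |δ| := mul_le_mul_of_nonneg_left h4 hC₁
        calc _ ≤ (n + C₁) * |δ| := by linarith
          _ ≤ _ := mul_le_mul_of_nonneg_left hδk (by positivity)
      have htg : t * (g - 1) ≤ 3 * (n + C₁) * B := by
        refine (le_abs_self _).trans ?_
        rw [abs_mul]
        calc _ ≤ (v z * (k / N)) * ((n + C₁) * (3 * k / (N * q))) :=
              mul_le_mul (hℓ y hy) hg1 (abs_nonneg _) (by positivity)
          _ = 3 * (n + C₁) * B * q := by rw [hB]; field_simp
          _ ≤ _ := mul_le_of_le_one_right (by positivity) hq1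
      have hvgexp : v z * (g - 1 - n * δ) ≤ 9 * C₁ * B := by
        calc _ ≤ v z * (C₁ * (9 * (k ^ 2 / (N ^ 2 * q ^ 2)))) := by
              refine mul_le_mul_of_nonneg_left ?_ hvz
              exact (le_abs_self _).trans (hex.trans (mul_le_mul_of_nonneg_left hsq hC₁))
          _ = _ := by rw [hB]; ring
      have hbδ : v z * (n * δ) = b * (distSq y x₀ - distSq z x₀) := by
        rw [hb, hδ]; field_simp
      have htexp : t = ∑ j, ℓ j * (y j : ℝ) - ∑ j, ℓ j * (z j : ℝ) := by
        rw [ht, ← Finset.sum_sub_distrib]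
        exact Finset.sum_congr rfl fun j _ => by ring
      have hFy : (v z + t - v y) * g ≤ F y := by
        have e : (v z + t - v y) * g = v z + t + v z * (n * δ) + v z * (g - 1 - n * δ) +
          t * (g - 1) - v y * g := by ring
        rw [e, hvg, hbδ, hF, hC₂]
        simp only
        linarith
      calc v z + t - v y ≤ (v z + t - v y) * ((3 / 2) ^ n * g) := le_mul_of_one_le_right hW hgl
        _ = (3 / 2) ^ n * ((v z + t - v y) * g) := by ring
        _ ≤ _ := mul_le_mul_of_nonneg_left hFy (by positivity)
    have h1 : evol ω k (fun y => v z + ∑ j, ℓ j * ((y j : ℝ) - z j) - v y) z ≤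
        (3 / 2) ^ n * evol ω k F z := by
      rw [← evol_mul_left]
      exact evol_mono k z fun y hy => (hpt y hy).2
    have h2 : evol ω k F z = v z + C₂ * B + b * k - q ^ n * evol ω k U z := by
      rw [hF, evol_add, hω.evol_affine, evol_add, evol_mul_left, evol_mul_left, hω.evol_distSq]
      ring
    have h3 : U z ≤ evol ω k U z := le_evol k z fun y hy => hU y (hpt y hy).1
    have h4 : v z ≤ q ^ n * evol ω k U z := by
      rw [hvU z hq.le]
      exact mul_le_mul_of_nonneg_left h3 (by positivity)
    have h5 : b * k ≤ n * B := by
      rw [hb, hB, div_mul_eq_mul_div, mul_div_assoc', div_le_div_iff₀ (by positivity) (by positivity)]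
      have : q * 1 ≤ 1 * k := mul_le_mul hq1 hk' zero_le_one zero_le_one
      have hpos : 0 ≤ (n : ℝ) * v z * k * (N ^ 2 * q) := by positivity
      nlinarith [mul_le_mul_of_nonneg_left this hpos]
    calc _ ≤ (3 / 2 : ℝ) ^ n * ((n + C₂) * B) :=
          h1.trans (mul_le_mul_of_nonneg_left (by rw [h2]; linarith) (by positivity))
      _ ≤ _ := by nlinarith
  -- Near the boundary the trivial bound `2 * v z` on the gap suffices, because `v z ≤ 36 * B`; this
  -- accounts for the summand 72.
  · push Not at hcase
    have h1 : evol ω k (fun y => v z + ∑ j, ℓ j * ((y j : ℝ) - z j) - v y) z ≤ 2 * v z := by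
      rw [← evol_const (ω := ω) (2 * v z) k z]
      refine evol_mono k z fun y hy => ?_
      have h2 := (le_abs_self _).trans (hℓ y hy)
      have h3 : v z * (k / N) ≤ v z * 1 :=
        mul_le_mul_of_nonneg_left ((div_le_one hN).mpr hkN') hvz
      have := hv0 y
      linarith
    have h2 : v z ≤ 36 * B := by
      rw [hB, mul_div_assoc', le_div_iff₀ (by positivity)]
      have : (N * q) ^ 2 ≤ (6 * k) ^ 2 := pow_le_pow_left₀ (by positivity) hcase.le 2
      nlinarith [mul_le_mul_of_nonneg_left this hvz]
    have h3 : 0 ≤ (3 / 2 : ℝ) ^ n * (n + C₂) * B := by positivity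
    nlinarith

/-- Two slopes in contact at the same point are close to each other. -/
theorem abs_slope_sub_le (hω : IsBalanced ω) {z : Site d} {k : ℕ} {v : Site d → ℝ}
    {ℓ ℓ' : Fin d → ℝ} {i : Fin d} (hi : avoid ω i k z ≤ 1 / 2)
    (h : ∀ y, l1 y z ≤ k → v y ≤ v z + ∑ j, ℓ j * ((y j : ℝ) - z j))
    (h' : ∀ y, l1 y z ≤ k → v y ≤ v z + ∑ j, ℓ' j * ((y j : ℝ) - z j)) :
    |ℓ' i - ℓ i| ≤ 4 * evol ω k (fun y => v z + ∑ j, ℓ j * ((y j : ℝ) - z j) - v y) z := by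
  set θ : Fin d → ℝ := fun j => ℓ' j - ℓ j with hθ
  set c : ℝ := -∑ j, θ j * (z j : ℝ) with hc
  have h1 := hω.le_evol_abs θ c i k z
  -- The two gaps `W`, `W'` are nonnegative, so `|W' - W| ≤ (W' - W) + 2 W`. Here `W' - W` is affine
  -- and vanishes at `z`, hence has mean zero.
  have h2 : evol ω k (fun y => |c + ∑ j, θ j * (y j : ℝ)|) z ≤
      evol ω k (fun y => (c + ∑ j, θ j * (y j : ℝ)) +
        2 * (v z + ∑ j, ℓ j * ((y j : ℝ) - z j) - v y)) z := by
    refine evol_mono k z fun y hy => ?_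
    have e : c + ∑ j, θ j * (y j : ℝ) =
        ∑ j, ℓ' j * ((y j : ℝ) - z j) - ∑ j, ℓ j * ((y j : ℝ) - z j) := by
      rw [hc, neg_add_eq_sub, ← Finset.sum_sub_distrib, ← Finset.sum_sub_distrib]
      exact Finset.sum_congr rfl fun j _ => by rw [hθ]; ring
    rw [e, abs_le]
    constructor <;> linarith [h y hy, h' y hy]
  rw [evol_add, evol_mul_left, hω.evol_affine, hc, neg_add_cancel, zero_add, ← hc] at h2
  have h3 : |θ i| * (1 / 2) ≤ |θ i| * (1 - avoid ω i k z) :=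
    mul_le_mul_of_nonneg_left (by linarith) (abs_nonneg _)
  have h4 : |ℓ' i - ℓ i| = |θ i| := rfl
  rw [h4]
  linarith

end contact

/-! ### Volumes in slope space and the ABP estimate -/

theorem mem_ball_iff_distSq {d : ℕ} {x₀ y : Site d} {r : ℝ} (hr : 0 ≤ r) :
    y ∈ ball x₀ r ↔ distSq y x₀ ≤ r ^ 2 := by
  rw [mem_ball, eDist, Real.sqrt_le_left hr, distSq]
  have : ∀ i, ((x₀ i : ℝ) - y i) ^ 2 = ((y i : ℝ) - x₀ i) ^ 2 := fun i => by ring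
  simp only [this]

theorem mem_ball_iff_cutoff {d : ℕ} {x₀ y : Site d} {N : ℝ} (hN : 0 < N) :
    y ∈ ball x₀ N ↔ 0 ≤ cutoff x₀ N y := by
  rw [mem_ball_iff_distSq hN.le, cutoff_nonneg_iff hN]

theorem self_mem_ball {d : ℕ} (x₀ : Site d) {r : ℝ} (hr : 0 ≤ r) : x₀ ∈ ball x₀ r := by
  rw [mem_ball_iff_distSq hr]
  simp only [distSq, sub_self]
  simpa using sq_nonneg r

theorem volume_pi_Icc_const {d : ℕ} (a : Fin d → ℝ) {c : ℝ} (hc : 0 ≤ c) :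
    volume (Set.Icc (fun i => a i - c) (fun i => a i + c)) = ENNReal.ofReal ((2 * c) ^ d) := by
  rw [Real.volume_Icc_pi]
  have : ∀ i, a i + c - (a i - c) = 2 * c := fun i => by ring
  simp [this, ENNReal.ofReal_pow (by positivity : 0 ≤ 2 * c)]

/-- If every slope of size at most `c` lies in one of finitely many cubes, then the volumes of the
cubes add up to at least that of the cube of slopes. -/
theorem pow_le_sum_pow_of_cover {d : ℕ} {ι : Type*} (A : Finset ι) {c : ℝ} (hc : 0 ≤ c)
    (χ : ι → Set (Fin d → ℝ)) (K : ι → ℝ) (hK : ∀ z ∈ A, 0 ≤ K z)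
    (hcov : ∀ ℓ : Fin d → ℝ, (∀ i, |ℓ i| ≤ c) → ∃ z ∈ A, ℓ ∈ χ z)
    (hχ : ∀ z ∈ A, ∀ ℓ ∈ χ z, ∀ ℓ' ∈ χ z, ∀ i, |ℓ' i - ℓ i| ≤ K z) :
    (2 * c) ^ d ≤ ∑ z ∈ A, (2 * K z) ^ d := by
  have h1 : Set.Icc (fun i : Fin d => (0 : ℝ) - c) (fun i => 0 + c) ⊆ ⋃ z ∈ A, χ z := by
    intro ℓ hℓ
    obtain ⟨z, hz, h⟩ := hcov ℓ fun i => abs_le.mpr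
      ⟨by simpa using hℓ.1 i, by simpa using hℓ.2 i⟩
    exact Set.mem_biUnion hz h
  -- Any member of `χ z` serves as the centre of a cube of half-side `K z` containing `χ z`.
  have h2 : ∀ z ∈ A, volume (χ z) ≤ ENNReal.ofReal ((2 * K z) ^ d) := by
    intro z hz
    rcases (χ z).eq_empty_or_nonempty with he | ⟨ℓ, hℓ⟩
    · simp [he]
    · rw [← volume_pi_Icc_const ℓ (hK z hz)]
      refine measure_mono fun ℓ' hℓ' => ⟨fun i => ?_, fun i => ?_⟩
      · linarith [(abs_le.mp (hχ z hz ℓ hℓ ℓ' hℓ' i)).1]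
      · linarith [(abs_le.mp (hχ z hz ℓ hℓ ℓ' hℓ' i)).2]
  have h3 : ENNReal.ofReal ((2 * c) ^ d) ≤ ENNReal.ofReal (∑ z ∈ A, (2 * K z) ^ d) := by
    rw [← volume_pi_Icc_const (fun _ : Fin d => (0 : ℝ)) hc, ENNReal.ofReal_sum_of_nonneg
      fun z hz => by have := hK z hz; positivity]
    exact (measure_mono h1).trans ((measure_biUnion_finset_le A χ).trans (Finset.sum_le_sum h2))
  exact (ENNReal.ofReal_le_ofReal_iff
    (Finset.sum_nonneg fun z hz => by have := hK z hz; positivity)).mp h3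

theorem abs_sum_mul_le {d : ℕ} {ℓ : Fin d → ℝ} {c : ℝ} (hℓ : ∀ i, |ℓ i| ≤ c) (y z : Site d) :
    |∑ j, ℓ j * ((y j : ℝ) - z j)| ≤ c * l1 y z := by
  rw [cast_l1, Finset.mul_sum]
  refine (Finset.abs_sum_le_sum_abs _ _).trans (Finset.sum_le_sum fun i _ => ?_)
  rw [abs_mul]
  exact mul_le_mul_of_nonneg_right (hℓ i) (abs_nonneg _)

/-- The Alexandrov-Bakelman-Pucci estimate for a localised power of a subharmonic function. -/
theorem exists_abp_bound (d m : ℕ) (hd : 0 < d) (hm : 0 < m) : ∃ C : ℝ, 0 < C ∧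
    ∀ ω : Environment d, IsBalanced ω → ∀ (x₀ : Site d) (N : ℕ), 1 ≤ N → ∀ κ : Site d → ℕ,
    (∀ z ∈ ball x₀ (N : ℝ), 1 ≤ κ z ∧ κ z ≤ N ∧ ∀ i, avoid ω i (κ z) z ≤ 1 / 2) →
    ∀ s : Site d → ℝ, (∀ y, 0 ≤ s y) →
    (∀ y ∈ ball x₀ (N : ℝ), s y ^ m ≤ ∑ e, prob ω y e * s (y + step e) ^ m) →
    ∀ y ∈ ball x₀ (N : ℝ), cutoff x₀ N y ^ (2 * d) * s y ≤
      C * ((1 / (N : ℝ) ^ d) * ∑ z ∈ ball x₀ (N : ℝ), (κ z : ℝ) ^ (2 * d) * s z) := by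
  classical
  obtain ⟨C₀, hC₀, hcontact⟩ := exists_contact_bound (2 * d * m)
  have hd' : (0 : ℝ) < d := by exact_mod_cast hd
  refine ⟨(32 * d * C₀) ^ d, by positivity, ?_⟩
  intro ω hω x₀ N hN1 κ hκ s hs hsub
  have hN : (0 : ℝ) < N := by exact_mod_cast hN1
  have hmem : ∀ y, y ∈ ball x₀ (N : ℝ) ↔ 0 ≤ cutoff x₀ N y := fun y => mem_ball_iff_cutoff hN
  set A := ball x₀ (N : ℝ) with hA
  set h : Site d → ℝ := fun y => cutoff x₀ N y ^ (2 * d) * s y with hh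
  set v : Site d → ℝ := fun y => if y ∈ A then h y ^ m else 0 with hv
  have hh0 : ∀ y ∈ A, 0 ≤ h y := fun y hy =>
    mul_nonneg (pow_nonneg ((hmem y).mp hy) _) (hs y)
  have hv0 : ∀ y, 0 ≤ v y := fun y => by
    simp only [hv]; split_ifs with hy
    · exact pow_nonneg (hh0 y hy) m
    · rfl
  obtain ⟨y₀, hy₀, hmax⟩ := A.exists_max_image h ⟨x₀, self_mem_ball x₀ hN.le⟩
  set μ := h y₀ with hμ
  suffices hmain : μ ≤ (32 * d * C₀) ^ d * ((1 / (N : ℝ) ^ d) *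
      ∑ z ∈ A, (κ z : ℝ) ^ (2 * d) * s z) from fun y hy => (hmax y hy).trans hmain
  rcases (hh0 y₀ hy₀).eq_or_lt with h0 | hμ0
  · rw [← hμ] at h0
    rw [← h0]
    have : 0 ≤ ∑ z ∈ A, (κ z : ℝ) ^ (2 * d) * s z :=
      Finset.sum_nonneg fun z _ => mul_nonneg (by positivity) (hs z)
    positivity
  rw [← hμ] at hμ0
  -- Within the box `Q` two sites have `ℓ¹` distance at most `4 * d * N`, so slopes of size `c`
  -- change values by at most `μ ^ m / 2`. This forces `v z ≥ μ ^ m / 2 > 0` at the contact point,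
  -- which thus lies in the ball. The half-width `2 * N` leaves room for walks of `κ z ≤ N` steps.
  set c : ℝ := μ ^ m / (8 * d * N) with hc
  have hc0 : 0 ≤ c := by positivity
  set Q : Finset (Site d) := Finset.Icc (fun i => x₀ i - 2 * N) (fun i => x₀ i + 2 * N) with hQ
  have hQmem : ∀ y, y ∈ Q ↔ ∀ i, |y i - x₀ i| ≤ 2 * N := by
    intro y
    rw [hQ, Finset.mem_Icc, Pi.le_def, Pi.le_def, ← forall_and]
    refine forall_congr' fun i => ?_
    rw [abs_le]; constructor <;> rintro ⟨h1, h2⟩ <;> constructor <;> linarith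
  have hAi : ∀ z ∈ A, ∀ i, |z i - x₀ i| ≤ N := by
    intro z hz i
    have := abs_sub_le_of_distSq_le hN.le ((mem_ball_iff_distSq hN.le).mp hz) i
    exact_mod_cast this
  have hnear : ∀ z ∈ A, ∀ y, l1 y z ≤ κ z → y ∈ Q := by
    intro z hz y hy
    rw [hQmem]
    intro i
    have h1 := natAbs_le_l1 y z i
    have h2 := hAi z hz i
    have h3 := (hκ z hz).2.1
    rw [abs_le] at h2 ⊢
    omega
  have hAQ : A ⊆ Q := fun z hz => hnear z hz z (by simp [l1_self])
  set A' := A.filter fun z => 0 < cutoff x₀ N z with hA'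
  let χ : Site d → Set (Fin d → ℝ) := fun z => {ℓ | (∀ i, |ℓ i| ≤ c) ∧ μ ^ m / 2 ≤ v z ∧
    ∀ y ∈ Q, v y ≤ v z + ∑ j, ℓ j * ((y j : ℝ) - z j)}
  let K : Site d → ℝ := fun z =>
    4 * (C₀ * (v z * κ z ^ 2 / (N ^ 2 * cutoff x₀ N z ^ 2)))
  have hK0 : ∀ z ∈ A', 0 ≤ K z := fun z _ => by have := hv0 z; positivity
  have hcov : ∀ ℓ : Fin d → ℝ, (∀ i, |ℓ i| ≤ c) → ∃ z ∈ A', ℓ ∈ χ z := by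
    intro ℓ hℓ
    obtain ⟨z, hz, hzmax⟩ := Q.exists_max_image (fun y => v y - ∑ j, ℓ j * (y j : ℝ))
      ⟨y₀, hAQ hy₀⟩
    have hcon : ∀ y ∈ Q, v y ≤ v z + ∑ j, ℓ j * ((y j : ℝ) - z j) := by
      intro y hy
      have := hzmax y hy
      have e : ∑ j, ℓ j * ((y j : ℝ) - z j) = ∑ j, ℓ j * (y j : ℝ) - ∑ j, ℓ j * (z j : ℝ) := by
        rw [← Finset.sum_sub_distrib]; exact Finset.sum_congr rfl fun j _ => by ring
      rw [e]; linarith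
    have hvy₀ : v y₀ = μ ^ m := by simp only [hv, hy₀, if_true]; rw [hμ]
    have hl : (l1 y₀ z : ℝ) ≤ 4 * d * N := by
      rw [cast_l1]
      refine (Finset.sum_le_card_nsmul _ _ (4 * (N : ℝ)) fun i _ => ?_).trans
        (le_of_eq (by simp; ring))
      have h1 := abs_le.mp ((hQmem y₀).mp (hAQ hy₀) i)
      have h2 := abs_le.mp ((hQmem z).mp hz i)
      have h3 : |y₀ i - z i| ≤ 4 * (N : ℤ) := by rw [abs_le]; omega
      exact_mod_cast h3
    have hvz : μ ^ m / 2 ≤ v z := by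
      have h1 := hcon y₀ (hAQ hy₀)
      have h2 := (le_abs_self _).trans (abs_sum_mul_le hℓ y₀ z)
      have h3 : c * l1 y₀ z ≤ c * (4 * d * N) := mul_le_mul_of_nonneg_left hl hc0
      have h4 : c * (4 * d * N) = μ ^ m / 2 := by rw [hc]; field_simp; norm_num
      linarith
    have hvpos : 0 < v z := lt_of_lt_of_le (by positivity) hvz
    have hzA : z ∈ A := by
      by_contra hn
      simp [hv, hn] at hvpos
    refine ⟨z, ?_, hℓ, hvz, hcon⟩
    rw [hA', Finset.mem_filter]
    refine ⟨hzA, lt_of_le_of_ne ((hmem z).mp hzA) fun hq => ?_⟩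
    simp [hv, hh, hzA, ← hq, hd.ne', hm.ne'] at hvpos
  have hvU : ∀ y, 0 ≤ cutoff x₀ N y → v y = cutoff x₀ N y ^ (2 * d * m) * s y ^ m := by
    intro y hy
    simp only [hv, (hmem y).mpr hy, if_true, hh]
    rw [mul_pow, ← pow_mul]
  have hχ : ∀ z ∈ A', ∀ ℓ ∈ χ z, ∀ ℓ' ∈ χ z, ∀ i, |ℓ' i - ℓ i| ≤ K z := by
    rintro z hz ℓ ⟨hℓ, hvz, hcon⟩ ℓ' ⟨hℓ', -, hcon'⟩ i
    obtain ⟨hzA, hqz⟩ := Finset.mem_filter.mp hz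
    obtain ⟨hκ1, hκN, hav⟩ := hκ z hzA
    refine (abs_slope_sub_le hω (hav i) (fun y hy => hcon y (hnear z hzA y hy))
      (fun y hy => hcon' y (hnear z hzA y hy))).trans ?_
    refine mul_le_mul_of_nonneg_left ?_ (by norm_num)
    refine hcontact hω x₀ z N (κ z) hκ1 hκN (fun y => s y ^ m) v ℓ hv0
      (fun y hy => hsub y ((hmem y).mpr hy)) hvU hqz ?_ (fun y hy => hcon y (hnear z hzA y hy))
    intro y hy
    refine (abs_sum_mul_le hℓ y z).trans ?_
    have h1 : (l1 y z : ℝ) ≤ κ z := by exact_mod_cast hy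
    have h2 : c ≤ v z / N := by
      rw [hc, div_le_div_iff₀ (by positivity) hN]
      have hd1 : (1 : ℝ) ≤ d := by exact_mod_cast hd
      have h3 : μ ^ m ≤ 2 * v z := by linarith
      have h4 : 2 * v z ≤ v z * (8 * d) := by nlinarith [hv0 z]
      calc μ ^ m * N ≤ (v z * (8 * d)) * N :=
            mul_le_mul_of_nonneg_right (h3.trans h4) hN.le
        _ = _ := by ring
    calc c * l1 y z ≤ (v z / N) * κ z :=
          mul_le_mul h2 h1 (Nat.cast_nonneg _) (div_nonneg (hv0 z) hN.le)
      _ = _ := by ring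
  have hvol := pow_le_sum_pow_of_cover A' hc0 χ K hK0 hcov hχ
  have hterm : ∀ z ∈ A', (2 * K z) ^ d ≤
      ((8 * C₀ / N ^ 2) ^ d * μ ^ (m * d - 1)) * ((κ z : ℝ) ^ (2 * d) * s z) := by
    intro z hz
    obtain ⟨hzA, hqz⟩ := Finset.mem_filter.mp hz
    obtain ⟨D, hD⟩ : ∃ D, m * d = D + 1 := ⟨m * d - 1, by have := Nat.mul_pos hm hd; omega⟩
    -- The exponent `2 * d` in `h` is chosen for this identity: dividing `h ^ (m * d)` by `q ^ (2 *
    -- d)` strips the cut-off from exactly one factor `h` and leaves `s`.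
    have e1 : (v z / cutoff x₀ N z ^ 2) ^ d = h z ^ (m * d - 1) * s z := by
      rw [div_pow, div_eq_iff (by positivity), hvU z hqz.le, hD, Nat.add_sub_cancel]
      simp only [hh]
      have e2 : 2 * d * m * d = 2 * d * D + 2 * d := by
        rw [mul_assoc, hD]; ring
      rw [mul_pow, ← pow_mul, ← pow_mul, e2, hD, mul_pow, ← pow_mul, ← pow_mul, pow_add, pow_succ]
      ring
    have e3 : (2 * K z) ^ d = ((8 * C₀ / N ^ 2) ^ d * (κ z : ℝ) ^ (2 * d)) *
        (v z / cutoff x₀ N z ^ 2) ^ d := by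
      rw [pow_mul, ← mul_pow, ← mul_pow]
      congr 1
      simp only [K]
      field_simp
      ring
    rw [e3, e1]
    have h1 : h z ^ (m * d - 1) ≤ μ ^ (m * d - 1) := pow_le_pow_left₀ (hh0 z hzA) (hmax z hzA) _
    have h2 := mul_le_mul_of_nonneg_right h1 (hs z)
    calc _ ≤ ((8 * C₀ / N ^ 2) ^ d * (κ z : ℝ) ^ (2 * d)) * (μ ^ (m * d - 1) * s z) :=
          mul_le_mul_of_nonneg_left h2 (by positivity)
      _ = _ := by ring
  have hsum : (2 * c) ^ d ≤ ((8 * C₀ / N ^ 2) ^ d * μ ^ (m * d - 1)) *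
      ∑ z ∈ A, (κ z : ℝ) ^ (2 * d) * s z := by
    refine hvol.trans ((Finset.sum_le_sum hterm).trans ?_)
    rw [← Finset.mul_sum]
    refine mul_le_mul_of_nonneg_left ?_ (by positivity)
    exact Finset.sum_le_sum_of_subset_of_nonneg (Finset.filter_subset _ _)
      fun z _ _ => mul_nonneg (by positivity) (hs z)
  obtain ⟨D, hD⟩ : ∃ D, m * d = D + 1 := ⟨m * d - 1, by have := Nat.mul_pos hm hd; omega⟩
  generalize ∑ z ∈ A, (κ z : ℝ) ^ (2 * d) * s z = S at hsum ⊢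
  have e4 : (2 * c) ^ d = μ ^ D * (μ / (4 * d * N) ^ d) := by
    have : 2 * c = μ ^ m / (4 * d * N) := by rw [hc]; field_simp; norm_num
    rw [this, div_pow, ← pow_mul, hD, pow_succ]; ring
  have e5 : ((8 * C₀ / N ^ 2) ^ d * μ ^ (m * d - 1)) * S =
      μ ^ D * ((8 * C₀ / N ^ 2) ^ d * S) := by
    rw [hD, Nat.add_sub_cancel]; ring
  rw [e4, e5] at hsum
  -- Cancelling `μ ^ (m * d - 1)` makes the estimate linear in both `μ` and `s`.
  have h6 := le_of_mul_le_mul_left hsum (by positivity)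
  rw [div_le_iff₀ (by positivity)] at h6
  refine h6.trans (le_of_eq ?_)
  have e7 : (8 * C₀ / (N : ℝ) ^ 2) ^ d * S * (4 * d * N) ^ d =
      (8 * C₀ / (N : ℝ) ^ 2 * (4 * d * N)) ^ d * S := by
    rw [mul_right_comm, ← mul_pow]
  have e8 : 8 * C₀ / (N : ℝ) ^ 2 * (4 * d * N) = (32 * d * C₀) * (1 / N) := by
    field_simp; norm_num
  rw [e7, e8, mul_pow, one_div_pow, mul_assoc]

/-! ### From the ABP estimate to the mean value inequality -/

/-- The box of all sites at distance at most `L` from `x₀` in the maximum norm. -/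
noncomputable def box {d : ℕ} (x₀ : Site d) (L : ℕ) : Finset (Site d) :=
  Finset.Icc (fun i => x₀ i - L) (fun i => x₀ i + L)

theorem mem_box {d : ℕ} {x₀ y : Site d} {L : ℕ} : y ∈ box x₀ L ↔ ∀ i, |y i - x₀ i| ≤ L := by
  rw [box, Finset.mem_Icc, Pi.le_def, Pi.le_def, ← forall_and]
  refine forall_congr' fun i => ?_
  rw [abs_le]
  constructor <;> rintro ⟨h1, h2⟩ <;> constructor <;> linarith

theorem card_box {d : ℕ} (x₀ : Site d) (L : ℕ) : (box x₀ L).card = (2 * L + 1) ^ d := by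
  rw [box, Pi.card_Icc]
  have : ∀ i, (Finset.Icc (x₀ i - L) (x₀ i + L)).card = 2 * L + 1 := fun i => by
    rw [Int.card_Icc]; omega
  simp [this]

theorem ball_subset_box {d : ℕ} (x₀ : Site d) {N L : ℕ} (h : N ≤ L) :
    ball x₀ (N : ℝ) ⊆ box x₀ L := by
  intro y hy
  rw [mem_box]
  intro i
  have := abs_sub_le_of_distSq_le (Nat.cast_nonneg N)
    ((mem_ball_iff_distSq (Nat.cast_nonneg N)).mp hy) i
  have h2 : |y i - x₀ i| ≤ N := by exact_mod_cast this
  omega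

theorem card_ball_le {d : ℕ} (x₀ : Site d) {N : ℕ} (hN : 1 ≤ N) :
    ((ball x₀ (N : ℝ)).card : ℝ) ≤ 3 ^ d * (N : ℝ) ^ d := by
  have h1 := Finset.card_le_card (ball_subset_box x₀ (le_refl N))
  rw [card_box] at h1
  have h2 : (2 * N + 1) ^ d ≤ (3 * N) ^ d := Nat.pow_le_pow_left (by omega) d
  rw [← mul_pow]
  exact_mod_cast h1.trans h2

theorem posPart_le_sum {d : ℕ} {ω : Environment d} {u : Site d → ℝ} {y : Site d}
    (h : gen ω u y = 0) :
    max (u y) 0 ≤ ∑ e, prob ω y e * max (u (y + step e)) 0 := by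
  have h1 : u y = ∑ e, prob ω y e * u (y + step e) := sub_eq_zero.mp h
  refine max_le ?_ (Finset.sum_nonneg fun e _ => mul_nonneg (prob_nonneg _ _ _) (le_max_right _ _))
  rw [h1]
  exact Finset.sum_le_sum fun e _ => mul_le_mul_of_nonneg_left (le_max_left _ _) (prob_nonneg _ _ _)

/-- Monotonicity of normalised power means. -/
theorem avg_le_avg_rpow {ι : Type*} (A : Finset ι) (hA : A.Nonempty) (f : ι → ℝ)
    (hf : ∀ z, 0 ≤ f z) {t : ℝ} (ht : 1 ≤ t) :
    ((1 / (A.card : ℝ)) * ∑ z ∈ A, f z) ^ t ≤ (1 / (A.card : ℝ)) * ∑ z ∈ A, f z ^ t := by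
  have hc : (0 : ℝ) < A.card := by exact_mod_cast hA.card_pos
  rw [Finset.mul_sum, Finset.mul_sum]
  refine Real.rpow_arith_mean_le_arith_mean_rpow A (fun _ => 1 / (A.card : ℝ)) f
    (fun _ _ => by positivity) ?_ (fun z _ => hf z) ht
  rw [Finset.sum_const, nsmul_eq_mul]
  field_simp

/-- The mean value inequality on a ball all of whose sites see every axis within a time scale `κ`
whose moment of order `4 d` is under control. -/
theorem exists_mean_value_of_scale (d : ℕ) {σ p C₁ : ℝ} (hσ : σ ∈ Set.Ioo (0 : ℝ) 1) (hp : 0 < p)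
    (hpd : p ≤ (d : ℝ)) (hC₁ : 0 < C₁) : ∃ C : ℝ, 0 < C ∧
    ∀ ω : Environment d, IsBalanced ω → ∀ (x₀ : Site d) (N : ℕ), 1 ≤ N → ∀ κ : Site d → ℕ,
    (∀ z ∈ ball x₀ (N : ℝ), 1 ≤ κ z ∧ κ z ≤ N ∧ ∀ i, avoid ω i (κ z) z ≤ 1 / 2) →
    ∑ z ∈ ball x₀ (N : ℝ), (κ z : ℝ) ^ (4 * d) ≤ C₁ * (N : ℝ) ^ d →
    ∀ u : Site d → ℝ, (∀ x ∈ ball x₀ (N : ℝ), gen ω u x = 0) →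
    ∀ x ∈ ball x₀ (σ * (N : ℝ)),
      u x ≤ C * avgNorm (ball x₀ (N : ℝ)) p (fun y => max (u y) 0) := by
  have hd : 0 < d := by
    have : (0 : ℝ) < d := hp.trans_le hpd
    exact_mod_cast this
  -- With `s = f ^ (1 / m)` the mean of `s ^ 2` is a mean of `f ^ (2 / m)`, and `2 / m ≤ p`.
  obtain ⟨m, hm⟩ := exists_nat_ge (2 / p)
  have hm0' : (0 : ℝ) < m := lt_of_lt_of_le (by positivity) hm
  have hm0 : 0 < m := by exact_mod_cast hm0'
  obtain ⟨C₂, hC₂, habp⟩ := exists_abp_bound d m hd hm0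
  obtain ⟨hσ0, hσ1⟩ := hσ
  have hτ : 0 < 1 - σ ^ 2 := by nlinarith
  set B : ℝ := C₂ ^ 2 * C₁ * 3 ^ d / (1 - σ ^ 2) ^ (4 * d) with hB
  have hB0 : 0 < B := by positivity
  refine ⟨B ^ ((m : ℝ) / 2), by positivity, ?_⟩
  intro ω hω x₀ N hN1 κ hκ hκsum u hu x hx
  have hN : (0 : ℝ) < N := by exact_mod_cast hN1
  set A := ball x₀ (N : ℝ) with hA
  set f : Site d → ℝ := fun y => max (u y) 0 with hf
  have hf0 : ∀ y, 0 ≤ f y := fun y => le_max_right _ _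
  set s : Site d → ℝ := fun y => f y ^ (1 / (m : ℝ)) with hs
  have hs0 : ∀ y, 0 ≤ s y := fun y => Real.rpow_nonneg (hf0 y) _
  have hsm : ∀ y, s y ^ m = f y := fun y => by
    rw [hs, one_div]; exact Real.rpow_inv_natCast_pow (hf0 y) hm0.ne'
  have hxd := (mem_ball_iff_distSq (by positivity)).mp hx
  have hxc : 1 - σ ^ 2 ≤ cutoff x₀ N x := by
    rw [cutoff]
    have : distSq x x₀ / (N : ℝ) ^ 2 ≤ σ ^ 2 := by
      rw [div_le_iff₀ (by positivity), ← mul_pow]; exact hxd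
    linarith
  have hxA : x ∈ A := (mem_ball_iff_cutoff hN).mpr (hτ.le.trans hxc)
  have h1 := habp ω hω x₀ N hN1 κ hκ s hs0
    (fun y hy => by simp only [hsm]; exact posPart_le_sum (hu y hy)) x hxA
  set S : ℝ := ∑ z ∈ A, (κ z : ℝ) ^ (2 * d) * s z with hS
  set T : ℝ := (1 / (A.card : ℝ)) * ∑ z ∈ A, s z ^ 2 with hT
  have hAne : A.Nonempty := ⟨x₀, self_mem_ball x₀ hN.le⟩
  have hcard : (0 : ℝ) < A.card := by exact_mod_cast hAne.card_pos
  have hS0 : 0 ≤ S := Finset.sum_nonneg fun z _ => mul_nonneg (by positivity) (hs0 z)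
  -- Cauchy–Schwarz separates the scales from `s`; this is where the moment of order `4 * d` enters.
  have hCS : S ^ 2 ≤ C₁ * 3 ^ d * (N : ℝ) ^ (2 * d) * T := by
    have h2 := Finset.sum_mul_sq_le_sq_mul_sq A (fun z => (κ z : ℝ) ^ (2 * d)) s
    simp only [← pow_mul] at h2
    have e : 2 * d * 2 = 4 * d := by ring
    rw [e] at h2
    have h3 : ∑ z ∈ A, s z ^ 2 ≤ 3 ^ d * (N : ℝ) ^ d * T := by
      have e2 : ∑ z ∈ A, s z ^ 2 = A.card * T := by rw [hT]; field_simp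
      have hT0 : 0 ≤ T := mul_nonneg (by positivity) (Finset.sum_nonneg fun z _ => sq_nonneg _)
      rw [e2]
      exact mul_le_mul_of_nonneg_right (card_ball_le x₀ hN1) hT0
    calc S ^ 2 ≤ _ := h2
      _ ≤ (C₁ * (N : ℝ) ^ d) * (3 ^ d * (N : ℝ) ^ d * T) :=
          mul_le_mul hκsum h3 (Finset.sum_nonneg fun z _ => sq_nonneg _) (by positivity)
      _ = _ := by ring
  have h4 : s x ^ 2 ≤ B * T := by
    have h5 : (1 - σ ^ 2) ^ (2 * d) * s x ≤ C₂ * ((1 / (N : ℝ) ^ d) * S) :=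
      (mul_le_mul_of_nonneg_right (pow_le_pow_left₀ hτ.le hxc _) (hs0 x)).trans h1
    have h6 := pow_le_pow_left₀ (mul_nonneg (by positivity) (hs0 x)) h5 2
    have h7 : (C₂ * ((1 / (N : ℝ) ^ d) * S)) ^ 2 ≤ C₂ ^ 2 * (C₁ * 3 ^ d * T) := by
      have e : (C₂ * ((1 / (N : ℝ) ^ d) * S)) ^ 2 = C₂ ^ 2 * (S ^ 2 / (N : ℝ) ^ (2 * d)) := by
        field_simp
        ring
      rw [e]
      refine mul_le_mul_of_nonneg_left ?_ (by positivity)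
      rw [div_le_iff₀ (by positivity)]
      linarith
    have e : B * T = C₂ ^ 2 * (C₁ * 3 ^ d * T) / (1 - σ ^ 2) ^ (4 * d) := by rw [hB]; ring
    rw [e, le_div_iff₀ (by positivity)]
    refine le_trans (le_of_eq ?_) (h6.trans h7)
    rw [mul_pow, ← pow_mul, mul_comm]
    congr 2
    ring
  have hT0 : 0 ≤ T := mul_nonneg (by positivity) (Finset.sum_nonneg fun z _ => sq_nonneg _)
  have ht : 1 ≤ (m : ℝ) * p / 2 := by
    rw [div_le_iff₀ hp] at hm
    linarith
  have hTp : T ^ ((m : ℝ) * p / 2) ≤ (1 / (A.card : ℝ)) * ∑ z ∈ A, |f z| ^ p := by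
    refine (avg_le_avg_rpow A hAne (fun z => s z ^ 2) (fun z => sq_nonneg _) ht).trans (le_of_eq ?_)
    congr 1
    refine Finset.sum_congr rfl fun z _ => ?_
    rw [abs_of_nonneg (hf0 z), hs, ← Real.rpow_natCast, ← Real.rpow_mul (hf0 z),
      ← Real.rpow_mul (hf0 z)]
    congr 1
    push_cast
    field_simp
  have hTn : T ^ ((m : ℝ) / 2) ≤ avgNorm A p f := by
    rw [avgNorm]
    refine le_trans (le_of_eq ?_) (Real.rpow_le_rpow (Real.rpow_nonneg hT0 _) hTp (by positivity))
    rw [← Real.rpow_mul hT0]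
    congr 1
    field_simp
  have hfx : f x = (s x ^ 2) ^ ((m : ℝ) / 2) := by
    rw [← hsm x, ← Real.rpow_natCast (s x) 2, ← Real.rpow_mul (hs0 x), ← Real.rpow_natCast (s x) m]
    congr 1
    push_cast
    field_simp
  calc u x ≤ f x := le_max_left _ _
    _ ≤ (B * T) ^ ((m : ℝ) / 2) := by
        rw [hfx]; exact Real.rpow_le_rpow (sq_nonneg _) h4 (by positivity)
    _ = B ^ ((m : ℝ) / 2) * T ^ ((m : ℝ) / 2) := Real.mul_rpow hB0.le hT0
    _ ≤ _ := mul_le_mul_of_nonneg_left hTn (by positivity)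

/-! ### Sites explored while an axis is avoided -/

/-- The jump probabilities of the walk that is killed when it jumps along the axis `i`. -/
noncomputable def offAxis {d : ℕ} (ω : Environment d) (i : Fin d) (z : Site d) (e : Dir d) : ℝ :=
  if e.1 = i then 0 else prob ω z e

/-- The probability that the walk, killed at its first jump along the axis `i`, makes `k` steps
from `z` and has then at least `r` sites among those it left and those of `S`. -/
noncomputable def avoidMany {d : ℕ} (ω : Environment d) (i : Fin d) (r : ℕ) :
    ℕ → Finset (Site d) → Site d → ℝ
  | 0, S, _ => if r ≤ S.card then 1 else 0
  | k + 1, S, z => ∑ e, offAxis ω i z e * avoidMany ω i r k (insert z S) (z + step e)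

/-- The probability that the walk, killed at its first jump along the axis `i`, makes `k` steps
from `z` and has then fewer than `r` sites among those it left and those of `S`. -/
noncomputable def avoidFew {d : ℕ} (ω : Environment d) (i : Fin d) (r : ℕ) :
    ℕ → Finset (Site d) → Site d → ℝ
  | 0, S, _ => if r ≤ S.card then 0 else 1
  | k + 1, S, z => ∑ e, offAxis ω i z e * avoidFew ω i r k (insert z S) (z + step e)

section

variable {d : ℕ} {ω : Environment d} {i : Fin d} {r : ℕ}

theorem offAxis_nonneg (z : Site d) (e : Dir d) : 0 ≤ offAxis ω i z e := by
  unfold offAxis; split_ifs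
  · rfl
  · exact prob_nonneg _ _ _

theorem offAxis_le_prob (z : Site d) (e : Dir d) : offAxis ω i z e ≤ prob ω z e := by
  unfold offAxis; split_ifs
  · exact prob_nonneg _ _ _
  · rfl

theorem sum_offAxis_le_one (z : Site d) : ∑ e, offAxis ω i z e ≤ 1 := by
  rw [← sum_prob ω z]
  exact Finset.sum_le_sum fun e _ => offAxis_le_prob z e

theorem avoid_eq_add (k : ℕ) (S : Finset (Site d)) (z : Site d) :
    avoid ω i k z = avoidMany ω i r k S z + avoidFew ω i r k S z := by
  induction k generalizing S z with
  | zero => simp only [avoid, avoidMany, avoidFew]; split_ifs <;> simp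
  | succ k ih =>
    simp only [avoid, avoidMany, avoidFew]
    rw [← Finset.sum_add_distrib]
    refine Finset.sum_congr rfl fun e _ => ?_
    rw [← mul_add, ← ih, offAxis]
    split_ifs <;> simp

theorem avoidMany_nonneg (k : ℕ) (S : Finset (Site d)) (z : Site d) :
    0 ≤ avoidMany ω i r k S z := by
  induction k generalizing S z with
  | zero => simp only [avoidMany]; split_ifs <;> simp
  | succ k ih => exact Finset.sum_nonneg fun e _ => mul_nonneg (offAxis_nonneg _ _) (ih _ _)

theorem avoidFew_nonneg (k : ℕ) (S : Finset (Site d)) (z : Site d) :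
    0 ≤ avoidFew ω i r k S z := by
  induction k generalizing S z with
  | zero => simp only [avoidFew]; split_ifs <;> simp
  | succ k ih => exact Finset.sum_nonneg fun e _ => mul_nonneg (offAxis_nonneg _ _) (ih _ _)

theorem avoidMany_le_one (k : ℕ) (S : Finset (Site d)) (z : Site d) :
    avoidMany ω i r k S z ≤ 1 := by
  have h1 := avoid_eq_add (ω := ω) (i := i) (r := r) k S z
  have h2 := avoid_le_one (ω := ω) i k z
  have h3 := avoidFew_nonneg (ω := ω) (i := i) (r := r) k S z
  linarith

theorem avoidFew_eq_zero (k : ℕ) {S : Finset (Site d)} (z : Site d) (h : r ≤ S.card) :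
    avoidFew ω i r k S z = 0 := by
  induction k generalizing S z with
  | zero => simp [avoidFew, h]
  | succ k ih =>
    refine Finset.sum_eq_zero fun e _ => ?_
    rw [ih _ (h.trans (Finset.card_le_card (Finset.subset_insert z S))), mul_zero]

theorem distSq_le_l1_sq (y z : Site d) : distSq y z ≤ (l1 y z : ℝ) ^ 2 := by
  rw [cast_l1, distSq]
  have : ∀ i, ((y i : ℝ) - z i) ^ 2 = |(y i : ℝ) - z i| ^ 2 := fun i => (sq_abs _).symm
  simp only [this]
  exact Finset.sum_sq_le_sq_sum_of_nonneg fun i _ => abs_nonneg _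

/-- A walk that visits few sites is confined to a ball, which is unlikely for a martingale. -/
theorem IsBalanced.avoidFew_le (hω : IsBalanced ω) (z₀ : Site d) (k : ℕ) (S : Finset (Site d))
    (z : Site d) (hS : ∀ s ∈ S, l1 s z₀ + 1 ≤ S.card) (hz : l1 z z₀ ≤ S.card) (hr : S.card ≤ r) :
    avoidFew ω i r k S z ≤ (1 - 1 / (2 * ((r : ℝ) + 1) ^ 2)) ^ k *
      ((2 * ((r : ℝ) + 1) ^ 2 - distSq z z₀) / ((r : ℝ) + 1) ^ 2) := by
  have hr0 : (0 : ℝ) ≤ r := Nat.cast_nonneg r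
  have hR : 0 < ((r : ℝ) + 1) ^ 2 := by positivity
  have hβ : 0 ≤ 1 - 1 / (2 * ((r : ℝ) + 1) ^ 2) := by
    rw [sub_nonneg, div_le_one (by positivity)]
    nlinarith
  have hφ : 1 ≤ (2 * ((r : ℝ) + 1) ^ 2 - distSq z z₀) / ((r : ℝ) + 1) ^ 2 := by
    rw [le_div_iff₀ hR]
    have h1 := distSq_le_l1_sq z z₀
    have h2 : (l1 z z₀ : ℝ) ≤ r := by exact_mod_cast hz.trans hr
    have h3 : (l1 z z₀ : ℝ) ^ 2 ≤ (r : ℝ) ^ 2 := pow_le_pow_left₀ (Nat.cast_nonneg _) h2 2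
    nlinarith
  rcases hr.eq_or_lt with h | h
  · rw [avoidFew_eq_zero k z h.ge]
    positivity
  induction k generalizing S z with
  | zero =>
    simp only [avoidFew, not_le.mpr h, if_false, pow_zero, one_mul]
    exact hφ
  | succ k ih =>
    -- The bounding quantity is at most 2 and its mean drops by `1 / (r + 1) ^ 2` at each step, a
    -- relative drop of at least `1 - β`.
    set β := 1 - 1 / (2 * ((r : ℝ) + 1) ^ 2) with hβdef
    have hins : (insert z S).card ≤ r := (Finset.card_insert_le z S).trans h
    -- The distance from `z₀` can reach a new value only through a new site, so it stays below the
    -- number of explored sites.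
    have hcond : (∀ s ∈ insert z S, l1 s z₀ + 1 ≤ (insert z S).card) ∧
        l1 z z₀ + 1 ≤ (insert z S).card := by
      by_cases hzS : z ∈ S
      · rw [Finset.insert_eq_of_mem hzS]
        exact ⟨hS, hS z hzS⟩
      · rw [Finset.card_insert_of_notMem hzS]
        refine ⟨fun s hs => ?_, by omega⟩
        rcases Finset.mem_insert.mp hs with rfl | hs
        · omega
        · have := hS s hs; omega
    have hstep : ∀ e, avoidFew ω i r k (insert z S) (z + step e) ≤
        β ^ k * ((2 * ((r : ℝ) + 1) ^ 2 - distSq (z + step e) z₀) / ((r : ℝ) + 1) ^ 2) := by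
      intro e
      have hl : l1 (z + step e) z₀ ≤ (insert z S).card := by
        have := l1_triangle (z + step e) z z₀
        rw [l1_add_step] at this
        have := hcond.2
        omega
      have hφ' : 1 ≤ (2 * ((r : ℝ) + 1) ^ 2 - distSq (z + step e) z₀) / ((r : ℝ) + 1) ^ 2 := by
        rw [le_div_iff₀ hR]
        have h1 := distSq_le_l1_sq (z + step e) z₀
        have h2 : (l1 (z + step e) z₀ : ℝ) ≤ r := by exact_mod_cast hl.trans hins
        have h3 : (l1 (z + step e) z₀ : ℝ) ^ 2 ≤ (r : ℝ) ^ 2 :=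
          pow_le_pow_left₀ (Nat.cast_nonneg _) h2 2
        nlinarith
      rcases hins.eq_or_lt with h' | h'
      · rw [avoidFew_eq_zero k _ h'.ge]
        positivity
      · exact ih (insert z S) (z + step e) hcond.1 hl hins hφ' h'
    calc avoidFew ω i r (k + 1) S z
        ≤ ∑ e, prob ω z e * (β ^ k *
          ((2 * ((r : ℝ) + 1) ^ 2 - distSq (z + step e) z₀) / ((r : ℝ) + 1) ^ 2)) := by
          refine Finset.sum_le_sum fun e _ => ?_
          exact mul_le_mul (offAxis_le_prob z e) (hstep e) (avoidFew_nonneg _ _ _)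
            (prob_nonneg _ _ _)
      _ = β ^ k * ((2 * ((r : ℝ) + 1) ^ 2 - distSq z z₀ - 1) / ((r : ℝ) + 1) ^ 2) := by
          have e1 : ∀ e, prob ω z e * (β ^ k *
              ((2 * ((r : ℝ) + 1) ^ 2 - distSq (z + step e) z₀) / ((r : ℝ) + 1) ^ 2)) =
              β ^ k / ((r : ℝ) + 1) ^ 2 * (prob ω z e * (2 * ((r : ℝ) + 1) ^ 2) -
                prob ω z e * distSq (z + step e) z₀) := fun e => by ring
          simp only [e1]
          rw [← Finset.mul_sum, Finset.sum_sub_distrib, ← Finset.sum_mul, sum_prob,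
            hω.sum_distSq]
          ring
      _ ≤ β ^ k * (β * ((2 * ((r : ℝ) + 1) ^ 2 - distSq z z₀) / ((r : ℝ) + 1) ^ 2)) := by
          refine mul_le_mul_of_nonneg_left ?_ (by positivity)
          rw [mul_div_assoc', div_le_div_iff_of_pos_right hR, hβdef, sub_mul, one_mul]
          have : 1 / (2 * ((r : ℝ) + 1) ^ 2) * (2 * ((r : ℝ) + 1) ^ 2 - distSq z z₀) ≤ 1 := by
            rw [div_mul_eq_mul_div, one_mul, div_le_one (by positivity)]
            linarith [distSq_nonneg z z₀]
          linarith
      _ = _ := by rw [pow_succ]; ring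

end

/-! ### Annealed bounds for avoiding an axis -/

section annealed

variable {d : ℕ} {ν : Measure (JumpLaw d)}

/-- The mean probability not to jump along the axis `i`. -/
noncomputable def meanOff (ν : Measure (JumpLaw d)) (i : Fin d) : ℝ :=
  ∫ ω, ∑ e, offAxis ω i 0 e ∂(iidLaw ν)

theorem meanOff_nonneg (i : Fin d) : 0 ≤ meanOff ν i :=
  integral_nonneg fun _ => Finset.sum_nonneg fun _ _ => offAxis_nonneg _ _

variable [IsProbabilityMeasure ν]

instance : IsProbabilityMeasure (iidLaw ν) := by unfold iidLaw; infer_instance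

theorem measurable_prob (z : Site d) (e : Dir d) : Measurable fun ω : Environment d => prob ω z e :=
  (measurable_pi_apply e).comp (measurable_subtype_coe.comp (measurable_pi_apply z))

theorem measurable_offAxis (i : Fin d) (z : Site d) (e : Dir d) :
    Measurable fun ω : Environment d => offAxis ω i z e := by
  unfold offAxis; split_ifs
  · exact measurable_const
  · exact measurable_prob z e

theorem measurable_avoidMany (i : Fin d) (r k : ℕ) (S : Finset (Site d)) (z : Site d) :
    Measurable fun ω : Environment d => avoidMany ω i r k S z := by
  induction k generalizing S z with
  | zero => exact measurable_const
  | succ k ih =>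
    exact Finset.measurable_sum _ fun e _ => (measurable_offAxis i z e).mul (ih _ _)

theorem measurable_avoid (i : Fin d) (k : ℕ) (z : Site d) :
    Measurable fun ω : Environment d => avoid ω i k z := by
  induction k generalizing z with
  | zero => exact measurable_const
  | succ k ih =>
    refine Finset.measurable_sum _ fun e _ => ?_
    split_ifs
    · exact measurable_const
    · exact (measurable_prob z e).mul (ih _)

/-- Functions of the environment on disjoint finite sets are independent. -/
theorem indepFun_of_dependsOn {F G : Environment d → ℝ} {S T : Finset (Site d)}
    (hF : Measurable F) (hG : Measurable G) (hFS : DependsOn F S) (hGT : DependsOn G T)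
    (hST : Disjoint S T) : ProbabilityTheory.IndepFun F G (iidLaw ν) := by
  classical
  obtain ⟨a₀⟩ : Nonempty (JumpLaw d) := nonempty_of_isProbabilityMeasure ν
  have hind : ProbabilityTheory.iIndepFun (fun (z : Site d) (ω : Environment d) => ω z)
      (iidLaw ν) :=
    ProbabilityTheory.iIndepFun_infinitePi (P := fun _ : Site d => ν) (X := fun _ a => a)
      (fun _ => measurable_id)
  have h := hind.indepFun_finset S T hST (fun z => measurable_pi_apply z)
  let ext (S : Finset (Site d)) (x : S → JumpLaw d) : Environment d :=
    fun z => if hz : z ∈ S then x ⟨z, hz⟩ else a₀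
  have hext : ∀ S, Measurable (ext S) := fun S => by
    refine measurable_pi_lambda _ fun z => ?_
    simp only [ext]
    split_ifs
    · exact measurable_pi_apply _
    · exact measurable_const
  have hfac : ∀ (S : Finset (Site d)) (F : Environment d → ℝ), DependsOn F S →
      F = (fun x => F (ext S x)) ∘ fun ω (z : S) => ω z := by
    intro S F hFS
    funext ω
    refine hFS fun z hz => ?_
    have : z ∈ S := hz
    simp [ext, this]
  rw [hfac S F hFS, hfac T G hGT]
  exact h.comp (hF.comp (hext S)) (hG.comp (hext T))

theorem integrable_of_mem_Icc {F : Environment d → ℝ} (hF : Measurable F)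
    (h : ∀ ω, F ω ∈ Set.Icc (0 : ℝ) 1) : Integrable F (iidLaw ν) :=
  Integrable.of_bound hF.aestronglyMeasurable 1 <| Filter.Eventually.of_forall fun ω => by
    rw [Real.norm_eq_abs, abs_of_nonneg (h ω).1]; exact (h ω).2

theorem integral_sum_offAxis (i : Fin d) (z : Site d) :
    ∫ ω, ∑ e, offAxis ω i z e ∂(iidLaw ν) = meanOff ν i := by
  have key : ∀ z : Site d, ∫ ω, ∑ e, offAxis ω i z e ∂(iidLaw ν) =
      ∫ a : JumpLaw d, ∑ e : Dir d, (if e.1 = i then 0 else a.1 e) ∂ν := by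
    intro z
    have hm : Measurable fun a : JumpLaw d => ∑ e : Dir d, (if e.1 = i then 0 else a.1 e) := by
      refine Finset.measurable_sum _ fun e _ => ?_
      split_ifs
      · exact measurable_const
      · exact (measurable_pi_apply e).comp measurable_subtype_coe
    have hmp := measurePreserving_eval_infinitePi (fun _ : Site d => ν) z
    conv_rhs => rw [← hmp.map_eq]
    rw [integral_map hmp.measurable.aemeasurable hm.aestronglyMeasurable]
    rfl
  rw [key, meanOff, key]

theorem meanOff_le_one (i : Fin d) : meanOff ν i ≤ 1 := by
  have h : ∫ ω, ∑ e, offAxis ω i 0 e ∂(iidLaw ν) ≤ ∫ _, (1 : ℝ) ∂(iidLaw ν) :=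
    integral_mono_of_nonneg
      (Filter.Eventually.of_forall fun _ => Finset.sum_nonneg fun _ _ => offAxis_nonneg _ _)
      (integrable_const _) (Filter.Eventually.of_forall fun _ => sum_offAxis_le_one _)
  simpa [meanOff] using h

theorem dependsOn_offAxis (i : Fin d) (z : Site d) (e : Dir d) :
    DependsOn (fun ω : Environment d => offAxis ω i z e) ({z} : Finset (Site d)) := by
  intro ω ω' h
  have : ω z = ω' z := h z (by simp)
  simp only [offAxis, prob, this]

/-- Each newly visited site gives the walk an independent chance to jump along the axis `i`. -/
theorem integral_mul_avoidMany_le (i : Fin d) (r k : ℕ) (S : Finset (Site d)) (z : Site d)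
    (F : Environment d → ℝ) (hF : Measurable F) (hF01 : ∀ ω, F ω ∈ Set.Icc (0 : ℝ) 1)
    (hFS : DependsOn F S) :
    ∫ ω, F ω * avoidMany ω i r k S z ∂(iidLaw ν) ≤
      (∫ ω, F ω ∂(iidLaw ν)) * meanOff ν i ^ (r - S.card) := by
  have hm0 := meanOff_nonneg (ν := ν) i
  have hm1 := meanOff_le_one (ν := ν) i
  induction k generalizing S z F with
  | zero =>
    have hI : 0 ≤ ∫ ω, F ω ∂(iidLaw ν) := integral_nonneg fun ω => (hF01 ω).1
    simp only [avoidMany]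
    split_ifs with h
    · simp [Nat.sub_eq_zero_of_le h]
    · simp only [mul_zero, integral_zero]; positivity
  | succ k ih =>
    have hm : ∀ e, Measurable fun ω : Environment d => F ω * offAxis ω i z e :=
      fun e => hF.mul (measurable_offAxis i z e)
    have h01 : ∀ e ω, F ω * offAxis ω i z e ∈ Set.Icc (0 : ℝ) 1 := fun e ω =>
      ⟨mul_nonneg (hF01 ω).1 (offAxis_nonneg _ _), mul_le_one₀ (hF01 ω).2 (offAxis_nonneg _ _)
        ((offAxis_le_prob z e).trans (prob_le_one _ _ _))⟩
    have hdep : ∀ e, DependsOn (fun ω : Environment d => F ω * offAxis ω i z e)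
        (insert z S : Finset (Site d)) := by
      intro e ω ω' h
      have h1 : F ω = F ω' := hFS fun y hy => h y (by
        rw [Finset.coe_insert]; exact Set.mem_insert_of_mem _ hy)
      have h2 : offAxis ω i z e = offAxis ω' i z e := dependsOn_offAxis i z e fun y hy =>
        h y (by
          rw [Finset.coe_singleton, Set.mem_singleton_iff] at hy
          rw [hy, Finset.coe_insert]; exact Set.mem_insert _ _)
      simp only [h1, h2]
    -- The weight of the first step is absorbed into `F`, which then depends on the environment on
    -- `insert z S` only; this is why the induction carries a general `F`.
    have hstep : ∫ ω, F ω * avoidMany ω i r (k + 1) S z ∂(iidLaw ν) ≤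
        (∫ ω, F ω * ∑ e, offAxis ω i z e ∂(iidLaw ν)) *
          meanOff ν i ^ (r - (insert z S).card) := by
      have e1 : ∀ ω, F ω * avoidMany ω i r (k + 1) S z =
          ∑ e, (F ω * offAxis ω i z e) * avoidMany ω i r k (insert z S) (z + step e) := by
        intro ω
        rw [avoidMany, Finset.mul_sum]
        exact Finset.sum_congr rfl fun e _ => by ring
      simp only [e1, Finset.mul_sum]
      rw [integral_finsetSum, integral_finsetSum, Finset.sum_mul]
      · exact Finset.sum_le_sum fun e _ => ih _ _ _ (hm e) (h01 e) (hdep e)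
      · exact fun e _ => integrable_of_mem_Icc (hm e) (h01 e)
      · intro e _
        refine integrable_of_mem_Icc ((hm e).mul (measurable_avoidMany _ _ _ _ _)) fun ω => ?_
        exact ⟨mul_nonneg (h01 e ω).1 (avoidMany_nonneg _ _ _),
          mul_le_one₀ (h01 e ω).2 (avoidMany_nonneg _ _ _) (avoidMany_le_one _ _ _)⟩
    refine hstep.trans ?_
    -- A revisited site contributes a factor at most 1. A new one is independent of `F` and
    -- contributes `meanOff ν i`.
    by_cases hzS : z ∈ S
    · rw [Finset.insert_eq_of_mem hzS]
      refine mul_le_mul_of_nonneg_right ?_ (by positivity)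
      refine integral_mono_of_nonneg (Filter.Eventually.of_forall fun ω => mul_nonneg (hF01 ω).1
        (Finset.sum_nonneg fun _ _ => offAxis_nonneg _ _)) (integrable_of_mem_Icc hF hF01)
        (Filter.Eventually.of_forall fun ω => ?_)
      exact mul_le_of_le_one_right (hF01 ω).1 (sum_offAxis_le_one z)
    · have hmsum : Measurable fun ω : Environment d => ∑ e, offAxis ω i z e :=
        Finset.measurable_sum _ fun e _ => measurable_offAxis i z e
      have hind : ProbabilityTheory.IndepFun F (fun ω => ∑ e, offAxis ω i z e) (iidLaw ν) := by
        refine indepFun_of_dependsOn (S := S) (T := {z}) hF hmsum hFS ?_ (by simpa using hzS)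
        intro ω ω' h
        exact Finset.sum_congr rfl fun e _ => dependsOn_offAxis i z e h
      have e2 := hind.integral_fun_mul_eq_mul_integral hF.aestronglyMeasurable
        hmsum.aestronglyMeasurable
      rw [e2, integral_sum_offAxis, Finset.card_insert_of_notMem hzS, mul_assoc, ← pow_succ']
      refine mul_le_mul_of_nonneg_left ?_ (integral_nonneg fun ω => (hF01 ω).1)
      exact pow_le_pow_of_le_one hm0 hm1 (by omega)

theorem integral_avoid_le (hbal : ∀ᵐ ω ∂(iidLaw ν), IsBalanced ω) (i : Fin d) (r k : ℕ)
    (z : Site d) : ∫ ω, avoid ω i k z ∂(iidLaw ν) ≤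
      meanOff ν i ^ r + 2 * (1 - 1 / (2 * ((r : ℝ) + 1) ^ 2)) ^ k := by
  have h1 := integral_mul_avoidMany_le (ν := ν) i r k ∅ z (fun _ => 1) measurable_const
    (fun _ => ⟨zero_le_one, le_rfl⟩) (fun _ _ _ => rfl)
  simp only [one_mul, Finset.card_empty, Nat.sub_zero, integral_const, probReal_univ, smul_eq_mul,
    mul_one] at h1
  have hint : Integrable (fun ω => avoidMany ω i r k ∅ z) (iidLaw ν) :=
    integrable_of_mem_Icc (measurable_avoidMany _ _ _ _ _)
      fun ω => ⟨avoidMany_nonneg _ _ _, avoidMany_le_one _ _ _⟩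
  have h2 : ∫ ω, avoid ω i k z ∂(iidLaw ν) ≤ ∫ ω, (avoidMany ω i r k ∅ z +
      2 * (1 - 1 / (2 * ((r : ℝ) + 1) ^ 2)) ^ k) ∂(iidLaw ν) := by
    refine integral_mono_of_nonneg (Filter.Eventually.of_forall fun ω => avoid_nonneg _ _ _)
      (hint.add (integrable_const _)) ?_
    filter_upwards [hbal] with ω hω
    rw [avoid_eq_add (r := r) k ∅ z]
    have h3 := hω.avoidFew_le (i := i) (r := r) z k ∅ z (by simp) (by simp [l1_self]) (by simp)
    have h4 : (2 * ((r : ℝ) + 1) ^ 2 - distSq z z) / ((r : ℝ) + 1) ^ 2 = 2 := by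
      have : distSq z z = 0 := by simp [distSq]
      rw [this]
      field_simp
      ring
    rw [h4] at h3
    linarith
  rw [integral_add hint (integrable_const _)] at h2
  simp only [integral_const, probReal_univ, smul_eq_mul, one_mul] at h2
  linarith

/-- A mean equal to 1 would almost surely forbid jumps along the axis at every one of the countably
many sites, against genuine `d`-dimensionality. -/
theorem meanOff_lt_one (hgen : ∀ᵐ ω ∂(iidLaw ν), IsGenuinelyDDim ω) (i : Fin d) :
    meanOff ν i < 1 := by
  by_contra hcon
  push Not at hcon
  have hzero : ∀ z : Site d, ∀ᵐ ω ∂(iidLaw ν), prob ω z (i, true) = 0 := by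
    intro z
    set g : Environment d → ℝ := fun ω => 1 - ∑ e, offAxis ω i z e with hg
    have hint : Integrable (fun ω : Environment d => ∑ e, offAxis ω i z e) (iidLaw ν) :=
      integrable_of_mem_Icc (Finset.measurable_sum _ fun e _ => measurable_offAxis i z e)
        fun ω => ⟨Finset.sum_nonneg fun _ _ => offAxis_nonneg _ _, sum_offAxis_le_one z⟩
    have hg0 : 0 ≤ g := fun ω => sub_nonneg.mpr (sum_offAxis_le_one z)
    have hgi : ∫ ω, g ω ∂(iidLaw ν) = 0 := by
      refine le_antisymm ?_ (integral_nonneg hg0)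
      rw [hg, integral_sub (integrable_const _) hint, integral_sum_offAxis]
      simpa using hcon
    have h := (integral_eq_zero_iff_of_nonneg hg0 ((integrable_const _).sub hint)).mp hgi
    filter_upwards [h] with ω hω
    have hω' : 1 - ∑ e, offAxis ω i z e = 0 := hω
    rw [← sum_prob ω z, ← Finset.sum_sub_distrib] at hω'
    have := (Finset.sum_eq_zero_iff_of_nonneg
      (fun e _ => sub_nonneg.mpr (offAxis_le_prob z e))).mp hω' (i, true) (Finset.mem_univ _)
    simpa [offAxis] using this
  obtain ⟨ω, h1, h2⟩ := ((ae_all_iff.mpr hzero).and hgen).exists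
  obtain ⟨z, hz⟩ := h2 (i, true)
  rw [h1 z] at hz
  exact lt_irrefl _ hz

end annealed

theorem exists_pow_mul_pow_le (a : ℕ) {ρ : ℝ} (h0 : 0 < ρ) (h1 : ρ < 1) :
    ∃ C : ℝ, 0 < C ∧ ∀ n : ℕ, ρ ^ n ≤ C / ((n : ℝ) + 1) ^ a := by
  obtain ⟨C, hC⟩ := (tendsto_pow_const_mul_const_pow_of_lt_one a h0.le h1).bddAbove_range
  have hC' : ∀ n : ℕ, (n : ℝ) ^ a * ρ ^ n ≤ C := fun n => hC ⟨n, rfl⟩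
  have hCpos : 0 < C := by
    have := hC' 1
    simp only [Nat.cast_one, one_pow, pow_one, one_mul] at this
    linarith
  refine ⟨C / ρ, by positivity, fun n => ?_⟩
  rw [le_div_iff₀ (by positivity), le_div_iff₀ h0]
  have := hC' (n + 1)
  push_cast at this
  rw [pow_succ] at this
  linarith

/-- A suitable number of visited sites makes the bound on the probability of avoiding an axis decay
faster than any power of time. -/
theorem exists_superpolynomial_bound (M : ℕ) {q : ℝ} (h0 : 0 ≤ q) (h1 : q < 1) :
    ∃ C : ℝ, 0 < C ∧ ∀ j : ℕ, ∃ r : ℕ,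
      q ^ r + 2 * (1 - 1 / (2 * ((r : ℝ) + 1) ^ 2)) ^ j ≤ C / ((j : ℝ) + 1) ^ M := by
  set ρ := max q (Real.exp (-(1 / 8))) with hρ
  have hρ0 : 0 < ρ := lt_max_of_lt_right (Real.exp_pos _)
  have hρ1 : ρ < 1 := max_lt h1 <| by
    rw [← Real.exp_zero]; exact Real.exp_lt_exp.mpr (by norm_num)
  obtain ⟨C, hC, hb⟩ := exists_pow_mul_pow_le (4 * M) hρ0 hρ1
  refine ⟨3 * C, by positivity, fun j => ?_⟩
  -- With `r` of order `j ^ (1/4)`, the exponent `j / (2 (r + 1) ^ 2)` is at least `r / 8`, so both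
  -- terms are bounded by multiples of `ρ ^ r`. A power of order `4 * M` in `r` is one of order `M`
  -- in `j`.
  have hex : ∃ r : ℕ, j < (r + 1) ^ 4 :=
    ⟨j, (Nat.lt_succ_self j).trans_le (Nat.le_self_pow (by norm_num) _)⟩
  set r := Nat.find hex with hr
  have hr1 : j < (r + 1) ^ 4 := Nat.find_spec hex
  have hr2 : r ^ 4 ≤ j := by
    rcases Nat.eq_zero_or_pos r with h | h
    · rw [h]; simp
    · have := Nat.find_min hex (m := r - 1) (by omega)
      rwa [not_lt, Nat.sub_add_cancel h] at this
  refine ⟨r, ?_⟩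
  have e1 : q ^ r ≤ ρ ^ r := pow_le_pow_left₀ h0 (le_max_left _ _) r
  have e2 : (1 - 1 / (2 * ((r : ℝ) + 1) ^ 2)) ^ j ≤ ρ ^ r := by
    have hr0 : (0 : ℝ) ≤ r := Nat.cast_nonneg r
    have h3 : 0 ≤ 1 - 1 / (2 * ((r : ℝ) + 1) ^ 2) := by
      rw [sub_nonneg, div_le_one (by positivity)]
      nlinarith
    calc (1 - 1 / (2 * ((r : ℝ) + 1) ^ 2)) ^ j
        ≤ Real.exp (-(1 / (2 * ((r : ℝ) + 1) ^ 2))) ^ j :=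
          pow_le_pow_left₀ h3 (Real.one_sub_le_exp_neg _) j
      _ = Real.exp (j * -(1 / (2 * ((r : ℝ) + 1) ^ 2))) := (Real.exp_nat_mul _ _).symm
      _ ≤ Real.exp (r * -(1 / 8)) := by
          rw [Real.exp_le_exp, mul_neg, mul_neg, neg_le_neg_iff, mul_one_div, mul_one_div,
            div_le_div_iff₀ (by norm_num) (by positivity)]
          have h5 : (r : ℝ) ^ 4 ≤ j := by exact_mod_cast hr2
          rcases Nat.eq_zero_or_pos r with h | h
          · rw [h]; simp
          · have h6 : (1 : ℝ) ≤ r := by exact_mod_cast h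
            have h7 : ((r : ℝ) + 1) ^ 2 ≤ 4 * (r : ℝ) ^ 2 := by nlinarith
            have h8 : (r : ℝ) ^ 3 ≤ (r : ℝ) ^ 4 := pow_le_pow_right₀ h6 (by norm_num)
            nlinarith [mul_le_mul_of_nonneg_left h7 hr0]
      _ = Real.exp (-(1 / 8)) ^ r := Real.exp_nat_mul _ _
      _ ≤ ρ ^ r := pow_le_pow_left₀ (Real.exp_pos _).le (le_max_right _ _) r
  have e3 : ((j : ℝ) + 1) ^ M ≤ ((r : ℝ) + 1) ^ (4 * M) := by
    rw [pow_mul]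
    refine pow_le_pow_left₀ (by positivity) ?_ M
    have : j + 1 ≤ (r + 1) ^ 4 := hr1
    exact_mod_cast this
  calc _ ≤ 3 * ρ ^ r := by linarith
    _ ≤ 3 * (C / ((r : ℝ) + 1) ^ (4 * M)) := by linarith [hb r]
    _ = 3 * C / ((r : ℝ) + 1) ^ (4 * M) := by ring
    _ ≤ _ := div_le_div_of_nonneg_left (by positivity) (by positivity) e3

/-! ### Slow sites: tails, means and variances -/

/-- The environments in which the walk from `z` may well miss some axis for `j` steps. -/
def slowSet {d : ℕ} (j : ℕ) (z : Site d) : Set (Environment d) :=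
  {ω | ∃ i, 1 / 2 < avoid ω i j z}

section

variable {d : ℕ}

theorem measurableSet_slowSet (j : ℕ) (z : Site d) : MeasurableSet (slowSet j z) := by
  have : slowSet j z = ⋃ i, {ω : Environment d | 1 / 2 < avoid ω i j z} := by
    ext ω; simp [slowSet]
  rw [this]
  exact MeasurableSet.iUnion fun i => measurableSet_lt measurable_const (measurable_avoid i j z)

theorem avoid_congr {ω ω' : Environment d} (i : Fin d) (k : ℕ) (z : Site d)
    (h : ∀ y ∈ box z k, ω y = ω' y) : avoid ω i k z = avoid ω' i k z := by
  induction k generalizing z with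
  | zero => rfl
  | succ k ih =>
    have hz : ω z = ω' z := h z (by rw [mem_box]; intro i; simp; positivity)
    have hstep : ∀ e, avoid ω i k (z + step e) = avoid ω' i k (z + step e) := by
      intro e
      refine ih _ fun y hy => h y ?_
      rw [mem_box] at hy ⊢
      intro l
      have h1 := hy l
      have h2 := natAbs_le_l1 (z + step e) z l
      rw [l1_add_step] at h2
      rw [abs_le] at h1 ⊢
      push_cast
      omega
    simp only [avoid, prob, hz, hstep]

/-- A truncated power of the first time at which all axes have been seen. -/
noncomputable def slowSum (m s : ℕ) (z : Site d) (ω : Environment d) : ℝ :=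
  ∑ j ∈ Finset.range s, ((j : ℝ) + 1) ^ m * (slowSet j z).indicator 1 ω

theorem slowSum_mem_Icc (m s : ℕ) (z : Site d) (ω : Environment d) :
    slowSum m s z ω ∈ Set.Icc (0 : ℝ) ((s : ℝ) ^ (m + 1)) := by
  have h0 : ∀ j, 0 ≤ (slowSet j z).indicator (1 : Environment d → ℝ) ω := fun j =>
    Set.indicator_nonneg (fun _ _ => zero_le_one) _
  have h1 : ∀ j, (slowSet j z).indicator (1 : Environment d → ℝ) ω ≤ 1 := fun j =>
    Set.indicator_le_self' (fun _ _ => zero_le_one) _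
  refine ⟨Finset.sum_nonneg fun j _ => mul_nonneg (by positivity) (h0 j), ?_⟩
  have : slowSum m s z ω ≤ ∑ j ∈ Finset.range s, (s : ℝ) ^ m := by
    refine Finset.sum_le_sum fun j hj => ?_
    have hjs : (j : ℝ) + 1 ≤ s := by exact_mod_cast Finset.mem_range.mp hj
    calc _ ≤ ((j : ℝ) + 1) ^ m * 1 := mul_le_mul_of_nonneg_left (h1 j) (by positivity)
      _ ≤ _ := by rw [mul_one]; exact pow_le_pow_left₀ (by positivity) hjs m
  refine this.trans (le_of_eq ?_)
  simp [pow_succ, mul_comm]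

theorem measurable_slowSum (m s : ℕ) (z : Site d) : Measurable (slowSum m s z) :=
  Finset.measurable_sum _ fun j _ =>
    (measurable_one.indicator (measurableSet_slowSet j z)).const_mul _

theorem dependsOn_slowSum (m s : ℕ) (z : Site d) : DependsOn (slowSum m s z) (box z s) := by
  intro ω ω' h
  refine Finset.sum_congr rfl fun j hj => ?_
  have hj' := Finset.mem_range.mp hj
  have : ∀ i, avoid ω i j z = avoid ω' i j z := fun i => avoid_congr i j z fun y hy => h y (by
    rw [Finset.mem_coe]
    rw [mem_box] at hy ⊢
    intro l
    have := hy l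
    omega)
  simp [Set.indicator_apply, slowSet, this]

variable {ν : Measure (JumpLaw d)} [IsProbabilityMeasure ν]

/-- Markov's inequality at level 1/2 for each axis, followed by a union bound over the axes. -/
theorem exists_slowSet_bound (hbal : ∀ᵐ ω ∂(iidLaw ν), IsBalanced ω)
    (hgen : ∀ᵐ ω ∂(iidLaw ν), IsGenuinelyDDim ω) (M : ℕ) :
    ∃ C : ℝ, 0 < C ∧ ∀ (j : ℕ) (z : Site d),
      (iidLaw ν).real (slowSet j z) ≤ C / ((j : ℝ) + 1) ^ M := by
  choose C hC hb using fun i : Fin d =>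
    exists_superpolynomial_bound M (meanOff_nonneg (ν := ν) i) (meanOff_lt_one hgen i)
  refine ⟨∑ i, 2 * C i + 1, ?_, fun j z => ?_⟩
  · have : 0 ≤ ∑ i, 2 * C i := Finset.sum_nonneg fun i _ => by linarith [hC i]
    linarith
  have hi : ∀ i, (iidLaw ν).real {ω | 1 / 2 < avoid ω i j z} ≤ 2 * C i / ((j : ℝ) + 1) ^ M := by
    intro i
    obtain ⟨r, hr⟩ := hb i j
    have h1 := mul_meas_ge_le_integral_of_nonneg (μ := iidLaw ν)
      (Filter.Eventually.of_forall fun ω => avoid_nonneg (ω := ω) i j z)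
      (integrable_of_mem_Icc (measurable_avoid i j z)
        fun ω => ⟨avoid_nonneg i j z, avoid_le_one i j z⟩) (1 / 2)
    have h2 := integral_avoid_le hbal i r j z
    have h3 : (iidLaw ν).real {ω | 1 / 2 < avoid ω i j z} ≤
        (iidLaw ν).real {ω | 1 / 2 ≤ avoid ω i j z} :=
      measureReal_mono fun ω (hω : 1 / 2 < avoid ω i j z) => hω.le
    rw [mul_div_assoc]
    linarith
  have hsub : slowSet j z = ⋃ i, {ω : Environment d | 1 / 2 < avoid ω i j z} := by
    ext ω; simp [slowSet]
  rw [hsub]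
  refine (measureReal_iUnion_fintype_le _).trans ((Finset.sum_le_sum fun i _ => hi i).trans ?_)
  rw [← Finset.sum_div]
  exact div_le_div_of_nonneg_right (by linarith) (by positivity)

theorem memLp_slowSum (m s : ℕ) (z : Site d) : MemLp (slowSum m s z) 2 (iidLaw ν) :=
  MemLp.of_bound (measurable_slowSum m s z).aestronglyMeasurable ((s : ℝ) ^ (m + 1))
    (Filter.Eventually.of_forall fun ω => by
      rw [Real.norm_eq_abs, abs_of_nonneg (slowSum_mem_Icc m s z ω).1]
      exact (slowSum_mem_Icc m s z ω).2)

/-- The tail exponent `m + 2` beats the weight `(j + 1) ^ m` by a summable `(j + 1) ^ (-2)`, which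
makes the bound uniform in the truncation `s`. -/
theorem exists_integral_slowSum_bound (hbal : ∀ᵐ ω ∂(iidLaw ν), IsBalanced ω)
    (hgen : ∀ᵐ ω ∂(iidLaw ν), IsGenuinelyDDim ω) (m : ℕ) :
    ∃ C : ℝ, 0 < C ∧ ∀ (s : ℕ) (z : Site d), ∫ ω, slowSum m s z ω ∂(iidLaw ν) ≤ C := by
  obtain ⟨C, hC, hb⟩ := exists_slowSet_bound hbal hgen (m + 2)
  have hsum : Summable fun j : ℕ => C * (1 / ((j : ℝ) + 1) ^ 2) := by
    refine Summable.mul_left C ?_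
    have := (summable_nat_add_iff 1).mpr (Real.summable_one_div_nat_pow.mpr one_lt_two)
    simpa using this
  refine ⟨∑' j : ℕ, C * (1 / ((j : ℝ) + 1) ^ 2) + 1, ?_, fun s z => ?_⟩
  · have : 0 ≤ ∑' j : ℕ, C * (1 / ((j : ℝ) + 1) ^ 2) := tsum_nonneg fun j => by positivity
    linarith
  have h1 : ∫ ω, slowSum m s z ω ∂(iidLaw ν) =
      ∑ j ∈ Finset.range s, ((j : ℝ) + 1) ^ m * (iidLaw ν).real (slowSet j z) := by
    unfold slowSum
    rw [integral_finsetSum]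
    · refine Finset.sum_congr rfl fun j _ => ?_
      rw [integral_const_mul, integral_indicator_one (measurableSet_slowSet j z)]
    · intro j _
      exact ((integrable_const (1 : ℝ)).indicator (measurableSet_slowSet j z)).const_mul _
  have h2 : ∑ j ∈ Finset.range s, ((j : ℝ) + 1) ^ m * (iidLaw ν).real (slowSet j z) ≤
      ∑ j ∈ Finset.range s, C * (1 / ((j : ℝ) + 1) ^ 2) := by
    refine Finset.sum_le_sum fun j _ => ?_
    calc _ ≤ ((j : ℝ) + 1) ^ m * (C / ((j : ℝ) + 1) ^ (m + 2)) :=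
          mul_le_mul_of_nonneg_left (hb j z) (by positivity)
      _ = _ := by rw [pow_add]; field_simp
  have h3 := hsum.sum_le_tsum (Finset.range s) fun j _ => by positivity
  linarith

/-- Truncation at `s` means that only the environment in `box z s` is read, so two such sums are
independent once their boxes are disjoint. For nearby sites the crude range bound is enough. -/
theorem covariance_slowSum_le (m s : ℕ) (z z' : Site d) :
    ProbabilityTheory.covariance (slowSum m s z) (slowSum m s z') (iidLaw ν) ≤
      if z' ∈ box z (2 * s) then ((s : ℝ) ^ (m + 1)) ^ 2 else 0 := by
  set b : ℝ := (s : ℝ) ^ (m + 1) with hb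
  have hb0 : 0 ≤ b := by positivity
  split_ifs with h
  · have hdev : ∀ (z : Site d) ω, |slowSum m s z ω - ∫ ω, slowSum m s z ω ∂(iidLaw ν)| ≤ b := by
      intro z ω
      have h1 := slowSum_mem_Icc m s z ω
      have h2 : 0 ≤ ∫ ω, slowSum m s z ω ∂(iidLaw ν) :=
        integral_nonneg fun ω => (slowSum_mem_Icc m s z ω).1
      have h3 : ∫ ω, slowSum m s z ω ∂(iidLaw ν) ≤ ∫ _, b ∂(iidLaw ν) :=
        integral_mono_of_nonneg (Filter.Eventually.of_forall fun ω => (slowSum_mem_Icc m s z ω).1)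
          (integrable_const _) (Filter.Eventually.of_forall fun ω => (slowSum_mem_Icc m s z ω).2)
      simp only [integral_const, probReal_univ, smul_eq_mul, one_mul] at h3
      rw [abs_le]
      constructor <;> linarith [h1.1, h1.2]
    refine (le_abs_self _).trans ?_
    rw [← Real.norm_eq_abs, ProbabilityTheory.covariance]
    refine (norm_integral_le_of_norm_le_const (C := b ^ 2)
      (Filter.Eventually.of_forall fun ω => ?_)).trans (le_of_eq (by simp))
    rw [norm_mul, sq]
    exact mul_le_mul (hdev z ω) (hdev z' ω) (abs_nonneg _) hb0
  · refine le_of_eq (ProbabilityTheory.IndepFun.covariance_eq_zero ?_ (memLp_slowSum m s z)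
      (memLp_slowSum m s z'))
    refine indepFun_of_dependsOn (measurable_slowSum m s z) (measurable_slowSum m s z')
      (dependsOn_slowSum m s z) (dependsOn_slowSum m s z') ?_
    rw [Finset.disjoint_left]
    intro y hy hy'
    apply h
    rw [mem_box] at hy hy' ⊢
    intro i
    have h1 := abs_le.mp (hy i)
    have h2 := abs_le.mp (hy' i)
    rw [abs_le]
    push_cast
    omega

theorem variance_sum_slowSum_le (m s : ℕ) (Q : Finset (Site d)) :
    ProbabilityTheory.variance (fun ω => ∑ z ∈ Q, slowSum m s z ω) (iidLaw ν) ≤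
      Q.card * (((4 * s + 1) ^ d : ℕ) * ((s : ℝ) ^ (m + 1)) ^ 2) := by
  rw [ProbabilityTheory.variance_fun_sum' fun z _ => memLp_slowSum m s z, ← nsmul_eq_mul]
  refine Finset.sum_le_card_nsmul _ _ _ fun z _ => ?_
  refine (Finset.sum_le_sum fun z' _ => covariance_slowSum_le m s z z').trans ?_
  rw [← Finset.sum_filter, Finset.sum_const, nsmul_eq_mul]
  refine mul_le_mul_of_nonneg_right ?_ (by positivity)
  have h1 : Finset.filter (fun z' => z' ∈ box z (2 * s)) Q ⊆ box z (2 * s) :=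
    fun y hy => (Finset.mem_filter.mp hy).2
  have h2 := Finset.card_le_card h1
  rw [card_box] at h2
  have e : 2 * (2 * s) + 1 = 4 * s + 1 := by ring
  rw [e] at h2
  exact_mod_cast h2

end

/-! ### Borel–Cantelli and moments of the escape scale -/

section

variable {d : ℕ}

/-- The first time scale at which the walk from `z` has probably jumped along every axis. -/
noncomputable def escapeScale (ω : Environment d) (z : Site d) : ℕ :=
  sInf {j | ω ∉ slowSet j z}

/-- The hypothesis supplies a scale that is not slow; without one, `sInf ∅ = 0` would be a
meaningless value. -/
theorem escapeScale_spec {ω : Environment d} {z : Site d} {s : ℕ} (hs : ω ∉ slowSet s z) :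
    escapeScale ω z ≤ s ∧ ∀ i, avoid ω i (escapeScale ω z) z ≤ 1 / 2 := by
  have hmem : s ∈ {j | ω ∉ slowSet j z} := hs
  refine ⟨Nat.sInf_le hmem, fun i => ?_⟩
  have h : ω ∉ slowSet (escapeScale ω z) z := Nat.sInf_mem ⟨s, hmem⟩
  simp only [slowSet, Set.mem_ofPred_eq, not_exists, not_lt] at h
  exact h i

theorem one_le_escapeScale (hd : 0 < d) {ω : Environment d} {z : Site d} {s : ℕ}
    (hs : ω ∉ slowSet s z) : 1 ≤ escapeScale ω z := by
  by_contra hcon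
  have h := (escapeScale_spec hs).2 ⟨0, hd⟩
  rw [show escapeScale ω z = 0 by omega] at h
  norm_num [avoid] at h

/-- By minimality the scale just before `escapeScale ω z` is slow, and its single term in `slowSum`
has weight `escapeScale ω z ^ m`. -/
theorem escapeScale_pow_le (hd : 0 < d) {ω : Environment d} {z : Site d} {s m : ℕ}
    (hs : ω ∉ slowSet s z) : (escapeScale ω z : ℝ) ^ m ≤ slowSum m s z ω := by
  obtain ⟨k, hk⟩ : ∃ k, escapeScale ω z = k + 1 :=
    ⟨escapeScale ω z - 1, by have := one_le_escapeScale hd hs; omega⟩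
  have hks : k < s := by have := (escapeScale_spec hs).1; omega
  have hslow : ω ∈ slowSet k z := by
    by_contra hn
    have : escapeScale ω z ≤ k := Nat.sInf_le hn
    omega
  have h := Finset.single_le_sum
    (f := fun j : ℕ => ((j : ℝ) + 1) ^ m * (slowSet j z).indicator (1 : Environment d → ℝ) ω)
    (fun j _ => mul_nonneg (by positivity) (Set.indicator_nonneg (fun _ _ => zero_le_one) _))
    (Finset.mem_range.mpr hks)
  simp only [Set.indicator_of_mem hslow, Pi.one_apply, mul_one] at h
  rw [hk]
  push_cast
  exact h

variable {ν : Measure (JumpLaw d)} [IsProbabilityMeasure ν]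

/-- The probability that the box of radius `s ^ a` contains slow sites at scale `s`, or too many
sites that are slow at smaller scales, is summable in `s`. -/
theorem exists_badBox_bound (hd : 0 < d) (hbal : ∀ᵐ ω ∂(iidLaw ν), IsBalanced ω)
    (hgen : ∀ᵐ ω ∂(iidLaw ν), IsGenuinelyDDim ω) (m : ℕ) :
    ∃ (a : ℕ) (C C' : ℝ), 1 ≤ a ∧ 0 < C ∧ ∀ (x₀ : Site d) (s : ℕ), 1 ≤ s →
      (iidLaw ν) {ω | (∃ z ∈ box x₀ (s ^ a), ω ∈ slowSet s z) ∨
        C * (box x₀ (s ^ a)).card ≤ ∑ z ∈ box x₀ (s ^ a), slowSum m s z ω} ≤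
      ENNReal.ofReal (C' * (1 / (s : ℝ) ^ 2)) := by
  -- The variance of the sum over the box is at most a multiple of its cardinality times `s ^ (d +
  -- 2m + 2)`. Chebyshev divides by the squared cardinality, which is at least `s ^ (2a)`, so this
  -- `a` leaves `s ^ (-2)`.
  set a := d + 2 * m + 4 with ha
  obtain ⟨C₁, hC₁, hmean⟩ := exists_integral_slowSum_bound hbal hgen m
  -- The box has order `s ^ (a * d)` sites, so this tail exponent leaves `s ^ (-2)` after the union
  -- bound.
  obtain ⟨C₂, hC₂, htail⟩ := exists_slowSet_bound hbal hgen (a * d + 2)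
  refine ⟨a, C₁ + 1, 3 ^ d * C₂ + 5 ^ d, by omega, by positivity, ?_⟩
  intro x₀ s hs
  have hs' : (1 : ℝ) ≤ s := by exact_mod_cast hs
  have hs0 : (0 : ℝ) < s := by linarith
  set Q := box x₀ (s ^ a) with hQ
  have hQcard : (Q.card : ℝ) = (2 * (s : ℝ) ^ a + 1) ^ d := by
    rw [hQ, card_box]; push_cast; rfl
  have hsa : (1 : ℝ) ≤ (s : ℝ) ^ a := one_le_pow₀ hs'
  have hQle : (Q.card : ℝ) ≤ 3 ^ d * (s : ℝ) ^ (a * d) := by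
    rw [hQcard, pow_mul, ← mul_pow]
    exact pow_le_pow_left₀ (by positivity) (by linarith) d
  have hQge : (s : ℝ) ^ a ≤ Q.card := by
    rw [hQcard]
    calc (s : ℝ) ^ a ≤ 2 * (s : ℝ) ^ a + 1 := by linarith
      _ ≤ _ := le_self_pow₀ (by linarith) hd.ne'
  have hQpos : (0 : ℝ) < Q.card := by linarith
  set Y : Environment d → ℝ := fun ω => ∑ z ∈ Q, slowSum m s z ω with hY
  have hYmean : ∫ ω, Y ω ∂(iidLaw ν) ≤ C₁ * Q.card := by
    rw [hY, integral_finsetSum _ fun z _ => (memLp_slowSum m s z).integrable (by norm_num)]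
    refine (Finset.sum_le_card_nsmul _ _ _ fun z _ => hmean s z).trans (le_of_eq ?_)
    rw [nsmul_eq_mul, mul_comm]
  have hYL : MemLp Y 2 (iidLaw ν) := memLp_finsetSum _ fun z _ => memLp_slowSum m s z
  have h1 : (iidLaw ν) (⋃ z ∈ Q, slowSet s z) ≤ ENNReal.ofReal (3 ^ d * C₂ * (1 / (s : ℝ) ^ 2)) := by
    rw [← ofReal_measureReal (measure_ne_top _ _)]
    refine ENNReal.ofReal_le_ofReal ?_
    have hs1 : ∀ z, (iidLaw ν).real (slowSet s z) ≤ C₂ / (s : ℝ) ^ (a * d + 2) := fun z =>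
      (htail s z).trans (div_le_div_of_nonneg_left hC₂.le (by positivity)
        (pow_le_pow_left₀ hs0.le (by linarith) _))
    refine (measureReal_biUnion_finset_le _ _).trans
      ((Finset.sum_le_card_nsmul _ _ _ fun z _ => hs1 z).trans ?_)
    rw [nsmul_eq_mul]
    calc _ ≤ (3 ^ d * (s : ℝ) ^ (a * d)) * (C₂ / (s : ℝ) ^ (a * d + 2)) :=
          mul_le_mul_of_nonneg_right hQle (by positivity)
      _ = _ := by rw [pow_add]; field_simp
  have h2 : (iidLaw ν) {ω | (Q.card : ℝ) ≤ |Y ω - ∫ ω, Y ω ∂(iidLaw ν)|} ≤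
      ENNReal.ofReal (5 ^ d * (1 / (s : ℝ) ^ 2)) := by
    refine (ProbabilityTheory.meas_ge_le_variance_div_sq hYL hQpos).trans
      (ENNReal.ofReal_le_ofReal ?_)
    have hv := variance_sum_slowSum_le (ν := ν) m s Q
    have hnear : (((4 * s + 1) ^ d : ℕ) : ℝ) ≤ 5 ^ d * (s : ℝ) ^ d := by
      rw [← mul_pow]
      push_cast
      exact pow_le_pow_left₀ (by positivity) (by linarith) d
    calc _ ≤ (Q.card * ((5 ^ d * (s : ℝ) ^ d) * ((s : ℝ) ^ (m + 1)) ^ 2)) / (Q.card : ℝ) ^ 2 := by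
          refine div_le_div_of_nonneg_right (hv.trans ?_) (by positivity)
          exact mul_le_mul_of_nonneg_left (mul_le_mul_of_nonneg_right hnear (by positivity))
            hQpos.le
      _ = (5 ^ d * (s : ℝ) ^ (d + 2 * m + 2)) / Q.card := by
          rw [show d + 2 * m + 2 = d + (m + 1) * 2 by ring, pow_add _ d, pow_mul]
          field_simp
      _ ≤ (5 ^ d * (s : ℝ) ^ (d + 2 * m + 2)) / (s : ℝ) ^ a :=
          div_le_div_of_nonneg_left (by positivity) (by positivity) hQge
      _ = _ := by
          rw [ha, show d + 2 * m + 4 = (d + 2 * m + 2) + 2 by ring, pow_add _ (d + 2 * m + 2) 2]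
          field_simp
  have hsub : {ω | (∃ z ∈ Q, ω ∈ slowSet s z) ∨ (C₁ + 1) * Q.card ≤ ∑ z ∈ Q, slowSum m s z ω} ⊆
      (⋃ z ∈ Q, slowSet s z) ∪ {ω | (Q.card : ℝ) ≤ |Y ω - ∫ ω, Y ω ∂(iidLaw ν)|} := by
    rintro ω (⟨z, hz, h⟩ | h)
    · exact Or.inl (Set.mem_biUnion hz h)
    · have h' : (C₁ + 1) * Q.card ≤ Y ω := h
      have h3 : (Q.card : ℝ) ≤ Y ω - ∫ ω, Y ω ∂(iidLaw ν) := by linarith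
      exact Or.inr (h3.trans (le_abs_self _))
  refine (measure_mono hsub).trans ((measure_union_le _ _).trans ((add_le_add h1 h2).trans ?_))
  rw [← ENNReal.ofReal_add (by positivity) (by positivity), ← add_mul]

/-- Almost surely, all large balls see every axis within a time scale whose moment of order `m` is
under control. -/
theorem exists_escapeScale_moment_bound (hd : 0 < d) (hbal : ∀ᵐ ω ∂(iidLaw ν), IsBalanced ω)
    (hgen : ∀ᵐ ω ∂(iidLaw ν), IsGenuinelyDDim ω) (m : ℕ) :
    ∃ C : ℝ, 0 < C ∧ ∀ x₀ : Site d, ∀ᵐ ω ∂(iidLaw ν), ∃ N₀ : ℕ, ∀ N : ℕ, N₀ ≤ N → 1 ≤ N ∧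
      (∀ z ∈ ball x₀ (N : ℝ), 1 ≤ escapeScale ω z ∧ escapeScale ω z ≤ N ∧
        ∀ i, avoid ω i (escapeScale ω z) z ≤ 1 / 2) ∧
      ∑ z ∈ ball x₀ (N : ℝ), (escapeScale ω z : ℝ) ^ m ≤ C * (N : ℝ) ^ d := by
  obtain ⟨a, C, C', ha, hC, hb⟩ := exists_badBox_bound hd hbal hgen m
  refine ⟨C * (3 * 2 ^ a) ^ d, by positivity, fun x₀ => ?_⟩
  have hsum : Summable fun t : ℕ => C' * (1 / ((t + 1 : ℕ) : ℝ) ^ 2) :=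
    ((summable_nat_add_iff 1).mpr (Real.summable_one_div_nat_pow.mpr one_lt_two)).mul_left C'
  have hbc := ae_eventually_notMem (ne_top_of_le_ne_top hsum.tsum_ofReal_ne_top
    (ENNReal.tsum_le_tsum fun t => hb x₀ (t + 1) (Nat.succ_pos t)))
  filter_upwards [hbc] with ω hω
  obtain ⟨t₀, ht₀⟩ := Filter.eventually_atTop.mp hω
  refine ⟨(t₀ + 1) ^ a + 1, fun N hN => ?_⟩
  have hN1 : 1 ≤ N := by omega
  -- The choice `t ^ a < N ≤ (t + 1) ^ a` makes the box of radius `(t + 1) ^ a` contain the ball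
  -- with volume of order `N ^ d`, and keeps the scale `t + 1` at most `N`.
  have hex : ∃ t : ℕ, N ≤ (t + 1) ^ a :=
    ⟨N, (Nat.le_succ N).trans (Nat.le_self_pow (by omega) _)⟩
  set t := Nat.find hex with ht
  have htN : N ≤ (t + 1) ^ a := Nat.find_spec hex
  have htt₀ : t₀ < t := by
    by_contra hcon
    have : (t + 1) ^ a ≤ (t₀ + 1) ^ a := Nat.pow_le_pow_left (by omega) a
    omega
  have hmin : t ^ a < N := by
    have := Nat.find_min hex (m := t - 1) (by omega)
    rwa [not_le, Nat.sub_add_cancel (by omega)] at this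
  have htN1 : t + 1 ≤ N := (Nat.le_self_pow (by omega) t).trans_lt hmin
  have hgood := ht₀ t htt₀.le
  simp only [not_or, not_exists, not_and, not_le] at hgood
  obtain ⟨hslow, hYlt⟩ := hgood
  have hsub := ball_subset_box x₀ htN
  refine ⟨hN1, fun z hz => ?_, ?_⟩
  · have h := hslow z (hsub hz)
    exact ⟨one_le_escapeScale hd h, (escapeScale_spec h).1.trans htN1, (escapeScale_spec h).2⟩
  · have h1 : ∑ z ∈ ball x₀ (N : ℝ), (escapeScale ω z : ℝ) ^ m ≤
        ∑ z ∈ box x₀ ((t + 1) ^ a), slowSum m (t + 1) z ω :=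
      (Finset.sum_le_sum fun z hz => escapeScale_pow_le hd (hslow z (hsub hz))).trans
        (Finset.sum_le_sum_of_subset_of_nonneg hsub fun z _ _ => (slowSum_mem_Icc m _ z ω).1)
    have h2 : 2 * (t + 1) ^ a + 1 ≤ 3 * 2 ^ a * N := by
      have h3 : (t + 1) ^ a ≤ (2 * t) ^ a := Nat.pow_le_pow_left (by omega) a
      rw [mul_pow] at h3
      have h4 : 2 ^ a * t ^ a ≤ 2 ^ a * N := Nat.mul_le_mul_left _ hmin.le
      have h5 : 1 ≤ (t + 1) ^ a := Nat.one_le_pow _ _ (by omega)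
      have h6 : 3 * 2 ^ a * N = 3 * (2 ^ a * N) := by ring
      omega
    have h7 : ((box x₀ ((t + 1) ^ a)).card : ℝ) ≤ (3 * 2 ^ a) ^ d * (N : ℝ) ^ d := by
      rw [card_box, ← mul_pow]
      exact_mod_cast Nat.pow_le_pow_left h2 d
    calc _ ≤ C * (box x₀ ((t + 1) ^ a)).card := h1.trans hYlt.le
      _ ≤ C * ((3 * 2 ^ a) ^ d * (N : ℝ) ^ d) := mul_le_mul_of_nonneg_left h7 hC.le
      _ = _ := by ring

end

end BalancedRWRE

theorem mainTheorem3 (d : ℕ) (ν : Measure (BalancedRWRE.JumpLaw d)) [IsProbabilityMeasure ν]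
    (hbal : ∀ᵐ ω ∂(BalancedRWRE.iidLaw ν), BalancedRWRE.IsBalanced ω)
    (hgen : ∀ᵐ ω ∂(BalancedRWRE.iidLaw ν), BalancedRWRE.IsGenuinelyDDim ω)
    (σ : ℝ) (hσ : σ ∈ Set.Ioo (0 : ℝ) 1) (p : ℝ) (hp : 0 < p) (hpd : p ≤ (d : ℝ)) :
    ∃ C : ℝ, 0 < C ∧ ∀ x₀ : BalancedRWRE.Site d,
      ∀ᵐ ω ∂(BalancedRWRE.iidLaw ν), ∃ N₀ : ℕ, ∀ N : ℕ, N₀ ≤ N →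
        ∀ u : BalancedRWRE.Site d → ℝ,
          (∀ x ∈ BalancedRWRE.ball x₀ (N : ℝ), BalancedRWRE.gen ω u x = 0) →
          ∀ x ∈ BalancedRWRE.ball x₀ (σ * (N : ℝ)),
            u x ≤ C * BalancedRWRE.avgNorm (BalancedRWRE.ball x₀ (N : ℝ)) p
              (fun y => max (u y) 0) := by
  have hd : 0 < d := by
    have : (0 : ℝ) < d := hp.trans_le hpd
    exact_mod_cast this
  -- The order `4 * d` is twice the power `2 * d` of the scale in the ABP estimate, as
  -- Cauchy–Schwarz requires.
  obtain ⟨C₁, hC₁, hscale⟩ := BalancedRWRE.exists_escapeScale_moment_bound hd hbal hgen (4 * d)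
  obtain ⟨C, hC, hmean⟩ := BalancedRWRE.exists_mean_value_of_scale d hσ hp hpd hC₁
  refine ⟨C, hC, fun x₀ => ?_⟩
  filter_upwards [hbal, hscale x₀] with ω hω ⟨N₀, hN₀⟩
  refine ⟨N₀, fun N hN u hu x hx => ?_⟩
  obtain ⟨hN1, hκ, hsum⟩ := hN₀ N hN
  exact hmean ω hω x₀ N hN1 (BalancedRWRE.escapeScale ω) hκ hsum u hu x hx
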